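/- **Setting.** Let $\mathfrak h$ be a finite-dimensional complex Hilbert space, let $V\subset\mathbb R^d$ be a locally finite lattice containing $0$ and positively generated by a finite set $S=\{s_1,\dots,s_v\}\neq\{0\}$, and let $L_1,\dots,L_v\in B(\mathfrak h)$ satisfy $\sum_j L_j^*L_j=1_{\mathfrak h}$. Let $\mathfrak L(\sigma)=\sum_j L_j\sigma L_j^*$ be the local channel and $\mathfrak L^*(x)=\sum_j L_j^*xL_j$ its dual. Let $\rho=\sum_{k\in V}\rho(k)\otimes|k\rangle\langle k|$ be a diagonal state, i.e. $\rho(k)\ge 0$ and $\sum_k\mathrm{Tr}\,\rho(k)=1$. On $\Omega=V\times J^{\mathbb N}$, $J=\{1,\dots,v\}$, with the $\sigma$-algebra generated by cylinder sets, let $\mathbb P_\rho$ be the measure with $$\mathbb P_\rho(\{(k,j_1,\dots,j_n)\}\times J^{\mathbb N})=\mathrm{Tr}(L_{j_n}\cdots L_{j_1}\rho(k)L_{j_1}^*\cdots L_{j_n}^*)\qquad(n\ge 0),$$ let $\mathcal F_n$ be the $\sigma$-algebra generated by $k$ and the first $n$ shifts, and for $\omega=(k,j_1,j_2,\dots)$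 let $\rho_0=\rho(k)/\mathrm{Tr}\,\rho(k)$ and $\rho_{n+1}=L_{j_{n+1}}\rho_nL_{j_{n+1}}^*/\mathrm{Tr}(L_{j_{n+1}}\rho_nL_{j_{n+1}}^*)$. An *enclosure* is a subspace $\mathcal W\subset\mathfrak h$ such that, for every $\omega\ge0$, $\mathrm{supp}\,\omega\subset\mathcal W$ implies $\mathrm{supp}\,\mathfrak L(\omega)\subset\mathcal W$; it is *minimal* if it is nonzero and contains no enclosure other than $\{0\}$ and itself. For an enclosure $\mathcal W$ with orthogonal projection $p_{\mathcal W}$, put $$A(\mathcal W)=\lim_{n}\mathfrak L^{*n}(p_{\mathcal W}),\qquad Y_n^{\mathcal W}=\mathrm{Tr}(A(\mathcal W)\rho_n),\qquad Y^{\mathcal W}_\infty=\lim_n Y^{\mathcal W}_n ,\qquad a_{\mathcal W}(\rho)=\mathbb E_\rho[Y_0^{\mathcal W}],$$ and, if $a_{\mathcal W}(\rho)>0$, let $\mathbb P_\rho^{\mathcal W}$ be the measure with density $Y^{\mathcal W}_\infty/a_{\mathcal W}(\rho)$ with respect to $\mathbb P_\rho$. Let $\mathcal R$ be the supremum of the supports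 of the invariant states of $\mathfrak L$, and let $\mathcal R=\bigoplus_{\alpha\in A}\chi_\alpha$ ($A$ finite) be its decomposition into mutually orthogonal enclosures, each of which is minimal among the nonzero enclosures $\mathcal E$ such that every minimal enclosure is either orthogonal to $\mathcal E$ or contained in $\mathcal E$. For each $\alpha$ let $\chi_\alpha=\bigoplus_{\beta\in I_\alpha}\mathcal V_{\alpha,\beta}$ ($I_\alpha$ finite) be any decomposition into mutually orthogonal minimal enclosures. Write $a_\alpha,\mathbb P^\alpha_\rho$ and $a_{\alpha,\beta},\mathbb P^{\alpha,\beta}_\rho$ for the above objects with $\mathcal W=\chi_\alpha$ and $\mathcal W=\mathcal V_{\alpha,\beta}$. **Lemma 4.2.** For every enclosure $\mathcal W$ the limit $A(\mathcal W)$ exists, the limit $Y_\infty^{\mathcal W}$ exists $\mathbb P_\rho$-almost surely, and, if $a_{\mathcal W}(\rho)>0$, $\mathbb P^{\mathcal W}_\rho$ is a probability measure with $$\frac{d\mathbb P_\rho^{\mathcal W}}{d\mathbb P_\rho}\Big|_{\mathcal F_n}=\frac{\mathrm{Tr}(A(\mathcal W)\rho_n)}{\mathbb E_\rho[\mathrm{Tr}(A(\mathcal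 W)\rho_0)]}\qquad(n\ge0).$$ Moreover $$a_\alpha(\rho)=\sum_{k\in V}\mathrm{Tr}(A(\chi_\alpha)\rho(k)),\qquad a_{\alpha,\beta}(\rho)=\sum_{k\in V}\mathrm{Tr}(A(\mathcal V_{\alpha,\beta})\rho(k)),$$ these weights are nonnegative with $\sum_\alpha a_\alpha(\rho)=\sum_{\alpha}\sum_{\beta} a_{\alpha,\beta}(\rho)=1$, and $\mathbb P_\rho$ is the convex combination $$\mathbb P_\rho=\sum_{\alpha\in A}a_\alpha(\rho)\,\mathbb P^\alpha_\rho=\sum_{\alpha\in A}\sum_{\beta\in I_\alpha}a_{\alpha,\beta}(\rho)\,\mathbb P^{\alpha,\beta}_\rho,$$ where terms of weight $0$ are read as $0$. -/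

import Mathlib

open MeasureTheory ProbabilityTheory Filter Topology
open scoped ENNReal

namespace OpenQuantumWalk

/-! ## Measures on sequences with prescribed cylinder probabilities -/

/-- Extension theorem for sequences over a finite alphabet: a consistent finite family of weights of
cylinder sets comes from a measure. Here `m n u` is the weight of the set of sequences that agree
with `u` in the first `n` places. -/
theorem exists_measure_of_cylinder_weights {J : Type} [Fintype J] [MeasurableSpace J]
    [MeasurableSingletonClass J] (m : ℕ → (ℕ → J) → ℝ≥0∞)
    (hdep : ∀ n u w, (∀ i < n, u i = w i) → m n u = m n w)
    (hsum : ∀ n u, m n u = ∑ j, m (n + 1) (Function.update u n j))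
    (hfin : ∀ u, m 0 u ≠ ∞) :
    ∃ Q : Measure (ℕ → J), ∀ n u, Q {w | ∀ i < n, w i = u i} = m n u := by
  classical
  rcases isEmpty_or_nonempty J with hJ | ⟨⟨j0⟩⟩
  · exact ⟨0, fun n u => (hJ.false (u 0)).elim⟩
  have hle : ∀ n u, m n u ≠ ∞ := by
    intro n
    induction n with
    | zero => exact hfin
    | succ n ih =>
      intro u
      have h1 : m (n + 1) u ≤ m n u := by
        rw [hsum n u]
        refine le_trans (le_of_eq ?_)
          (Finset.single_le_sum (f := fun j => m (n + 1) (Function.update u n j))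
            (fun _ _ => zero_le) (Finset.mem_univ (u n)))
        simp
      exact ne_top_of_le_ne_top (ih u) h1
  -- the first coordinate is a dummy; the history is extended to a full sequence
  let ext : (n : ℕ) → (Finset.Iic n → J) → ℕ → J := fun n h i =>
    if hi : i + 1 ≤ n then h ⟨i + 1, Finset.mem_Iic.2 hi⟩ else j0
  let step : (n : ℕ) → (Finset.Iic n → J) → Measure J := fun n h =>
    if m n (ext n h) = 0 then Measure.dirac j0
    else ∑ j, (m (n + 1) (Function.update (ext n h) n j) / m n (ext n h)) • Measure.dirac j
  let κ : (n : ℕ) → Kernel (Finset.Iic n → J) J := fun n =>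
    ⟨step n, measurable_of_countable _⟩
  have hκ : ∀ n, IsMarkovKernel (κ n) := by
    intro n
    refine ⟨fun h => ⟨?_⟩⟩
    change step n h Set.univ = 1
    simp only [step]
    split_ifs with h0
    · simp
    · rw [Measure.finsetSum_apply]
      simp only [Measure.smul_apply, measure_univ, smul_eq_mul, mul_one]
      simp only [div_eq_mul_inv]
      rw [← Finset.sum_mul, ← hsum, ENNReal.mul_inv_cancel h0 (hle _ _)]
  let x0 : Finset.Iic 0 → J := fun _ => j0
  let P : Measure (ℕ → J) := Kernel.traj (X := fun _ => J) κ 0 x0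
  let C : ℕ → (ℕ → J) → Set (ℕ → J) := fun n u => {x | ∀ i < n, x (i + 1) = u i}
  have hCm : ∀ n u, MeasurableSet (C n u) := by
    intro n u
    have : C n u = ⋂ i, ⋂ (_ : i < n), (fun x : ℕ → J => x (i + 1)) ⁻¹' {u i} := by
      ext x; simp [C]
    rw [this]
    exact MeasurableSet.iInter fun i => MeasurableSet.iInter fun _ =>
      (measurable_pi_apply (i + 1)) (measurableSet_singleton _)
  have key : ∀ n u, m 0 u * P (C n u) = m n u := by
    intro n
    induction n with
    | zero => intro u; simp [C, P]
    | succ n ih =>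
      intro u
      let S : Set (Finset.Iic n → J) :=
        {h | ∀ i (hi : i + 1 ≤ n), h ⟨i + 1, Finset.mem_Iic.2 hi⟩ = u i}
      have hSm : MeasurableSet S := (Set.toFinite S).measurableSet
      have hrestr : ∀ h : Finset.Iic n → J,
          Kernel.traj (X := fun _ => J) κ n h (C (n + 1) u)
            = S.indicator (fun h => κ n h {u n}) h := by
        intro h
        have hfix : ∀ᵐ x ∂(Kernel.traj (X := fun _ => J) κ n h),
            ∀ i : Finset.Iic n, x i = h i := by
          have h2 := Kernel.traj_map_frestrictLe_apply (X := fun _ => J) (κ := κ) n n h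
          rw [Kernel.partialTraj_self, Kernel.id_apply] at h2
          have h3 : ∀ᵐ y ∂(Measure.dirac h), y = h := by
            rw [ae_dirac_eq]; exact rfl
          rw [← h2] at h3
          have h4 := ae_of_ae_map (Preorder.measurable_frestrictLe n).aemeasurable h3
          filter_upwards [h4] with x hx i
          rw [← hx]; rfl
        by_cases hS : h ∈ S
        · rw [Set.indicator_of_mem hS]
          have h5 := congrArg (fun k : Kernel _ _ => k h {u n})
            (Kernel.map_traj_succ_self (X := fun _ => J) (κ := κ) (a := n))
          rw [← h5, Kernel.map_apply' _ (by fun_prop) _ (measurableSet_singleton _)]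
          refine measure_congr ?_
          filter_upwards [hfix] with x hx
          refine propext ?_
          change (∀ i < n + 1, x (i + 1) = u i) ↔ x (n + 1) = u n
          constructor
          · intro H; exact H n (Nat.lt_succ_self n)
          · intro H i hi
            rcases Nat.lt_succ_iff_lt_or_eq.1 hi with hi | rfl
            · rw [← hS i hi]; exact hx ⟨i + 1, Finset.mem_Iic.2 hi⟩
            · exact H
        · rw [Set.indicator_of_notMem hS]
          refine (measure_eq_zero_iff_ae_notMem).2 ?_
          filter_upwards [hfix] with x hx hxC
          refine hS fun i hi => ?_
          rw [← hx ⟨i + 1, Finset.mem_Iic.2 hi⟩]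
          exact hxC i (by omega)
      have hval : ∀ h ∈ S, κ n h {u n} =
          if m n u = 0 then Measure.dirac j0 {u n} else m (n + 1) u / m n u := by
        intro h hS
        have he : ∀ i < n, ext n h i = u i := by
          intro i hi
          have hi' : i + 1 ≤ n := hi
          simp only [ext, hi', dif_pos]
          exact hS i hi'
        change step n h {u n} = _
        simp only [step]
        rw [hdep n _ _ he]
        split_ifs with h0
        · rfl
        · rw [Measure.finsetSum_apply, Finset.sum_eq_single (u n)]
          · rw [Measure.smul_apply, Measure.dirac_apply_of_mem (Set.mem_singleton _),
              smul_eq_mul, mul_one]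
            congr 1
            refine hdep _ _ _ fun i hi => ?_
            rcases Nat.lt_succ_iff_lt_or_eq.1 hi with hi | rfl
            · rw [Function.update_of_ne hi.ne]; exact he i hi
            · simp
          · intro j _ hj
            simp [hj]
          · simp
      have hP : P (C (n + 1) u) = (∫⁻ h in S, κ n h {u n}
          ∂(Kernel.partialTraj (X := fun _ => J) κ 0 n x0)) := by
        have h6 := Kernel.traj_comp_partialTraj (X := fun _ => J) (κ := κ) (Nat.zero_le n)
        change Kernel.traj (X := fun _ => J) κ 0 x0 (C (n + 1) u) = _
        rw [← h6, Kernel.comp_apply' _ _ _ (hCm _ _), ← lintegral_indicator hSm]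
        exact lintegral_congr hrestr
      have hPn : P (C n u) = Kernel.partialTraj (X := fun _ => J) κ 0 n x0 S := by
        rw [← Kernel.traj_map_frestrictLe_apply, Measure.map_apply
          (Preorder.measurable_frestrictLe n) hSm]
        congr 1
      rw [hP, setLIntegral_congr_fun hSm hval, setLIntegral_const, ← hPn, mul_left_comm, ih u]
      split_ifs with h0
      · rw [h0, mul_zero]
        have h1 := hsum n u
        rw [h0] at h1
        have h2 := (Finset.sum_eq_zero_iff.1 h1.symm) (u n) (Finset.mem_univ _)
        simpa using h2.symm
      · exact ENNReal.div_mul_cancel h0 (hle _ _)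
  have hsh : Measurable fun (x : ℕ → J) (i : ℕ) => x (i + 1) := by fun_prop
  refine ⟨m 0 (fun _ => j0) • P.map (fun x i => x (i + 1)), fun n u => ?_⟩
  have hm : MeasurableSet {w : ℕ → J | ∀ i < n, w i = u i} := by
    have : {w : ℕ → J | ∀ i < n, w i = u i}
        = ⋂ i, ⋂ (_ : i < n), (fun x : ℕ → J => x i) ⁻¹' {u i} := by
      ext x; simp
    rw [this]
    exact MeasurableSet.iInter fun i => MeasurableSet.iInter fun _ =>
      (measurable_pi_apply i) (measurableSet_singleton _)
  rw [Measure.smul_apply, Measure.map_apply hsh hm, smul_eq_mul,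
    hdep 0 _ u (by intro i hi; omega)]
  exact key n u

/-! ## Enclosures, recurrence and absorption for maps on operators

The local space `H` is a finite dimensional complex Hilbert space, so all operators on it are
bounded and trace class. -/

section Operators

variable {H : Type*} [NormedAddCommGroup H] [InnerProductSpace ℂ H]

/-- The trace of an operator. -/
noncomputable def tr (x : H →L[ℂ] H) : ℂ := LinearMap.trace ℂ H (x : H →ₗ[ℂ] H)

open scoped ComplexOrder in
theorem re_tr_nonneg {x : H →L[ℂ] H} (hx : x.IsPositive) : 0 ≤ (tr x).re :=
  (Complex.nonneg_iff.1 (LinearMap.IsPositive.trace_nonneg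
    ((ContinuousLinearMap.isPositive_toLinearMap_iff x).2 hx))).1

/-- The support of a (positive) operator: the orthogonal complement of its kernel. -/
noncomputable def supp (x : H →L[ℂ] H) : Submodule ℂ H := (LinearMap.ker (x : H →ₗ[ℂ] H))ᗮ

/-- `W` is an enclosure (invariant domain) for the map `Φ`. -/
def IsEnclosure (Φ : (H →L[ℂ] H) →ₗ[ℂ] (H →L[ℂ] H)) (W : Submodule ℂ H) : Prop :=
  ∀ ω : H →L[ℂ] H, ω.IsPositive → supp ω ≤ W → supp (Φ ω) ≤ W

/-- A minimal enclosure: a nonzero enclosure containing no other enclosure but `{0}`. -/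
def IsMinimalEnclosure (Φ : (H →L[ℂ] H) →ₗ[ℂ] (H →L[ℂ] H)) (W : Submodule ℂ H) : Prop :=
  Minimal (fun U => IsEnclosure Φ U ∧ U ≠ ⊥) W

/-- The fast recurrent space: the supremum of the supports of the invariant states. -/
def recurrentSpace (Φ : (H →L[ℂ] H) →ₗ[ℂ] (H →L[ℂ] H)) : Submodule ℂ H :=
  sSup {U | ∃ ω : H →L[ℂ] H, ω.IsPositive ∧ tr ω = 1 ∧ Φ ω = ω ∧ U = supp ω}

/-- A nonzero enclosure `E` such that every minimal enclosure is either orthogonal to `E` or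
contained in `E`. -/
def IsSaturatedEnclosure (Φ : (H →L[ℂ] H) →ₗ[ℂ] (H →L[ℂ] H)) (E : Submodule ℂ H) : Prop :=
  IsEnclosure Φ E ∧ E ≠ ⊥ ∧ ∀ W, IsMinimalEnclosure Φ W → W ⟂ E ∨ W ≤ E

/-- `(χ α)` is the canonical orthogonal decomposition of the fast recurrent space: the `χ α` are
mutually orthogonal, each is minimal among the saturated enclosures, and they span the fast
recurrent space. -/
structure IsRecurrentDecomposition (Φ : (H →L[ℂ] H) →ₗ[ℂ] (H →L[ℂ] H)) {A : Type*}
    (χ : A → Submodule ℂ H) : Prop where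
  minimal : ∀ α, Minimal (IsSaturatedEnclosure Φ) (χ α)
  orthogonal : ∀ α α', α ≠ α' → χ α ⟂ χ α'
  iSup_eq : ⨆ α, χ α = recurrentSpace Φ

/-- `(V β)` is a decomposition of `E` into mutually orthogonal minimal enclosures. -/
structure IsMinimalDecomposition (Φ : (H →L[ℂ] H) →ₗ[ℂ] (H →L[ℂ] H)) (E : Submodule ℂ H)
    {I : Type*} (V : I → Submodule ℂ H) : Prop where
  minimal : ∀ β, IsMinimalEnclosure Φ (V β)
  orthogonal : ∀ β β', β ≠ β' → V β ⟂ V β'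
  iSup_eq : ⨆ β, V β = E

end Operators

/-! ## Homogeneous open quantum random walks -/

/-- A homogeneous open quantum random walk with local space `H` on a locally finite lattice in `ℝ^d`
that contains `0` and is positively generated by the finite set of shifts `s 0, …, s (v - 1)`. -/
structure HOQRW (d : ℕ) (H : Type*) [NormedAddCommGroup H] [InnerProductSpace ℂ H]
    [CompleteSpace H] where
  lattice : AddSubmonoid (EuclideanSpace ℝ (Fin d))
  v : ℕ
  shift : Fin v → EuclideanSpace ℝ (Fin d)
  /-- the Kraus operator attached to each shift -/
  L : Fin v → H →L[ℂ] H
  locallyFinite : ∀ r : ℝ, {x | x ∈ lattice ∧ ‖x‖ ≤ r}.Finite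
  shift_injective : Function.Injective shift
  generates : AddSubmonoid.closure (Set.range shift) = lattice
  nontrivial : Set.range shift ≠ {0}
  kraus : ∑ j, star (L j) * L j = 1

namespace HOQRW

section Dynamics

variable {d : ℕ} {H : Type*} [NormedAddCommGroup H] [InnerProductSpace ℂ H] [CompleteSpace H]

/-- The local channel `σ ↦ ∑ⱼ Lⱼ σ Lⱼ*`. -/
noncomputable def localChannel (q : HOQRW d H) : (H →L[ℂ] H) →ₗ[ℂ] (H →L[ℂ] H) where
  toFun σ := ∑ j, q.L j * σ * star (q.L j)
  map_add' σ τ := by simp [mul_add, add_mul, Finset.sum_add_distrib]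
  map_smul' c σ := by simp [Finset.smul_sum]

/-- The dual of the local channel, `x ↦ ∑ⱼ Lⱼ* x Lⱼ`. -/
noncomputable def dualChannel (q : HOQRW d H) : (H →L[ℂ] H) →ₗ[ℂ] (H →L[ℂ] H) where
  toFun x := ∑ j, star (q.L j) * x * q.L j
  map_add' σ τ := by simp [mul_add, add_mul, Finset.sum_add_distrib]
  map_smul' c σ := by simp [Finset.smul_sum]

theorem tr_mul_dualChannel (q : HOQRW d H) (ω x : H →L[ℂ] H) :
    tr (ω * q.dualChannel x) = tr (q.localChannel ω * x) := by
  simp only [tr, localChannel, dualChannel, LinearMap.coe_mk, AddHom.coe_mk, Finset.mul_sum,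
    Finset.sum_mul, ContinuousLinearMap.toLinearMap_sum, map_sum]
  refine Finset.sum_congr rfl fun j _ => ?_
  have h := LinearMap.trace_mul_comm ℂ ((ω * star (q.L j) * x : H →L[ℂ] H) : H →ₗ[ℂ] H)
    ((q.L j : H →L[ℂ] H) : H →ₗ[ℂ] H)
  simpa [mul_assoc, ContinuousLinearMap.toLinearMap_mul] using h

/-- The sites of the lattice, with the σ-algebra of all subsets. -/
def Site (q : HOQRW d H) : Type := {x // x ∈ q.lattice}

instance (q : HOQRW d H) : MeasurableSpace q.Site := ⊤

/-- The sample space: an initial site `k` and an infinite sequence of shift indices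
`(j₁, j₂, …)`, where `j_{n+1}` is the value of the sequence at `n`; it carries the σ-algebra
generated by the cylinder sets. -/
abbrev Path (q : HOQRW d H) : Type := q.Site × (ℕ → Fin q.v)

/-- `ℱ n` is generated by the initial site and the first `n` shifts. -/
noncomputable def filtration (q : HOQRW d H) : Filtration ℕ (inferInstance : MeasurableSpace q.Path) where
  seq n := MeasurableSpace.comap (fun ω : q.Path => (ω.1, fun i : Fin n => ω.2 i)) inferInstance
  mono' n m hnm := by
    have h : (fun ω : q.Path => (ω.1, fun i : Fin n => ω.2 i))
        = (fun p : q.Site × (Fin m → Fin q.v) => (p.1, fun i : Fin n => p.2 (Fin.castLE hnm i))) ∘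
          (fun ω : q.Path => (ω.1, fun i : Fin m => ω.2 i)) := rfl
    simp only
    rw [h, ← MeasurableSpace.comap_comp]
    exact MeasurableSpace.comap_mono (Measurable.comap_le (by fun_prop))
  le' n := Measurable.comap_le (by fun_prop)

/-- A state of the walk that is diagonal with respect to the position,
`∑ₖ ρ(k) ⊗ |k⟩⟨k|`, with positive blocks `ρ(k)` and total trace one. -/
structure DiagonalState (q : HOQRW d H) where
  block : q.Site → H →L[ℂ] H
  positive : ∀ k, (block k).IsPositive
  hasSum_tr : HasSum (fun k => tr (block k)) 1

/-- The unnormalised evolution `L_{jₙ} ⋯ L_{j₁} σ L_{j₁}* ⋯ L_{jₙ}*` along a sequence of shifts. -/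
noncomputable def evolve (q : HOQRW d H) (σ : H →L[ℂ] H) (u : ℕ → Fin q.v) : ℕ → H →L[ℂ] H
  | 0 => σ
  | n + 1 => q.L (u n) * evolve q σ u n * star (q.L (u n))

theorem evolve_congr (q : HOQRW d H) (σ : H →L[ℂ] H) (u w : ℕ → Fin q.v) (n : ℕ)
    (h : ∀ i < n, u i = w i) : q.evolve σ u n = q.evolve σ w n := by
  induction n with
  | zero => rfl
  | succ n ih =>
    rw [evolve, evolve, ih fun i hi => h i (by omega), h n (by omega)]

theorem evolve_isPositive (q : HOQRW d H) {σ : H →L[ℂ] H} (hσ : σ.IsPositive)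
    (u : ℕ → Fin q.v) (n : ℕ) : (q.evolve σ u n).IsPositive := by
  induction n with
  | zero => exact hσ
  | succ n ih => exact ih.conj_adjoint (q.L (u n))

theorem tr_localChannel (q : HOQRW d H) (σ : H →L[ℂ] H) : tr (q.localChannel σ) = tr σ := by
  have h := q.tr_mul_dualChannel σ 1
  have h1 : q.dualChannel 1 = 1 := by
    simpa [dualChannel] using q.kraus
  rw [h1, mul_one, mul_one] at h
  exact h.symm

end Dynamics

section Trajectories

variable {d : ℕ} {H : Type*} [NormedAddCommGroup H] [InnerProductSpace ℂ H] [CompleteSpace H]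
  [FiniteDimensional ℂ H]

/-- Existence of the (unnormalised) law of the sequence of shifts for the local initial state `σ`:
its cylinder probabilities are `Tr(L_{jₙ} ⋯ L_{j₁} σ L_{j₁}* ⋯ L_{jₙ}*)`. -/
theorem exists_shiftLaw (q : HOQRW d H) {σ : H →L[ℂ] H} (hσ : σ.IsPositive) :
    ∃ Q : Measure (ℕ → Fin q.v), ∀ n u,
      Q {w | ∀ i < n, w i = u i} = ENNReal.ofReal (tr (q.evolve σ u n)).re := by
  refine exists_measure_of_cylinder_weights
    (fun n u => ENNReal.ofReal (tr (q.evolve σ u n)).re) ?_ ?_ ?_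
  · intro n u w h
    simp only [q.evolve_congr σ u w n h]
  · intro n u
    have h1 : tr (q.evolve σ u n)
        = ∑ j, tr (q.evolve σ (Function.update u n j) (n + 1)) := by
      rw [← q.tr_localChannel]
      simp only [tr, localChannel, LinearMap.coe_mk, AddHom.coe_mk,
        ContinuousLinearMap.toLinearMap_sum, map_sum]
      refine Finset.sum_congr rfl fun j _ => ?_
      rw [evolve, Function.update_self, q.evolve_congr σ u (Function.update u n j) n]
      intro i hi
      rw [Function.update_of_ne hi.ne]
    rw [← ENNReal.ofReal_sum_of_nonneg, h1, Complex.re_sum]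
    intro j _
    exact re_tr_nonneg (q.evolve_isPositive hσ _ _)
  · intro u
    exact ENNReal.ofReal_ne_top

/-- The unnormalised law of the sequence of shifts, determined by its cylinder probabilities. -/
noncomputable def shiftLaw (q : HOQRW d H) {σ : H →L[ℂ] H} (hσ : σ.IsPositive) :
    Measure (ℕ → Fin q.v) :=
  (q.exists_shiftLaw hσ).choose

/-- The measure `ℙ_ρ` on the sample space. -/
noncomputable def trajectoryMeasure (q : HOQRW d H) (ρ : q.DiagonalState) : Measure q.Path :=
  Measure.sum fun k => (q.shiftLaw (ρ.positive k)).map fun w => (k, w)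

/-- The cylinder probabilities that characterise `ℙ_ρ`. -/
theorem trajectoryMeasure_cylinder (q : HOQRW d H) (ρ : q.DiagonalState) (k : q.Site) (n : ℕ)
    (u : ℕ → Fin q.v) :
    q.trajectoryMeasure ρ {ω | ω.1 = k ∧ ∀ i < n, ω.2 i = u i}
      = ENNReal.ofReal (tr (q.evolve (ρ.block k) u n)).re := by
  have hm : MeasurableSet {ω : q.Path | ω.1 = k ∧ ∀ i < n, ω.2 i = u i} := by
    have : {ω : q.Path | ω.1 = k ∧ ∀ i < n, ω.2 i = u i}
        = (fun ω : q.Path => ω.1) ⁻¹' {k} ∩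
          ⋂ i, ⋂ (_ : i < n), (fun ω : q.Path => ω.2 i) ⁻¹' {u i} := by
      ext x; simp
    rw [this]
    refine (measurable_fst (MeasurableSpace.measurableSet_top)).inter ?_
    exact MeasurableSet.iInter fun i => MeasurableSet.iInter fun _ =>
      (by fun_prop : Measurable fun ω : q.Path => ω.2 i) (measurableSet_singleton _)
  have hmap : ∀ k' : q.Site, Measurable fun w : ℕ → Fin q.v => (k', w) := fun k' => by fun_prop
  rw [trajectoryMeasure, Measure.sum_apply _ hm, tsum_eq_single k]
  · rw [Measure.map_apply (hmap k) hm, ← (q.exists_shiftLaw (ρ.positive k)).choose_spec n u]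
    simp [shiftLaw]
  · intro k' hk'
    rw [Measure.map_apply (hmap k') hm]
    simp [hk']

/-- The internal state `ρₙ` of the quantum trajectory. (It is set to `0` after a step of
probability zero.) -/
noncomputable def internalState (q : HOQRW d H) (ρ : q.DiagonalState) :
    ℕ → q.Path → H →L[ℂ] H
  | 0, ω => (tr (ρ.block ω.1))⁻¹ • ρ.block ω.1
  | n + 1, ω =>
    (tr (q.L (ω.2 n) * internalState q ρ n ω * star (q.L (ω.2 n))))⁻¹ •
      (q.L (ω.2 n) * internalState q ρ n ω * star (q.L (ω.2 n)))

/-- The absorption operator `A(W) = limₙ 𝔏*ⁿ(p_W)` of an enclosure `W` of the local channel. -/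
noncomputable def absorption (q : HOQRW d H) (W : Submodule ℂ H) : H →L[ℂ] H :=
  limUnder atTop fun n : ℕ => (q.dualChannel ^ n) W.starProjection

/-- The random variables `Yₙ = Tr(A(W) ρₙ)`. -/
noncomputable def absorbedMass (q : HOQRW d H) (ρ : q.DiagonalState) (W : Submodule ℂ H)
    (n : ℕ) (ω : q.Path) : ℝ :=
  (tr (q.absorption W * q.internalState ρ n ω)).re

/-- The limit `Y_∞ = limₙ Yₙ`. -/
noncomputable def absorbedMassLimit (q : HOQRW d H) (ρ : q.DiagonalState) (W : Submodule ℂ H)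
    (ω : q.Path) : ℝ :=
  limUnder atTop fun n : ℕ => q.absorbedMass ρ W n ω

/-- The weight `a_W(ρ) = 𝔼_ρ[Y₀] = 𝔼_ρ[Tr(A(W) ρ₀)]`. -/
noncomputable def absorptionWeight (q : HOQRW d H) (ρ : q.DiagonalState) (W : Submodule ℂ H) : ℝ :=
  ∫ ω, q.absorbedMass ρ W 0 ω ∂(q.trajectoryMeasure ρ)

/-- The measure with density `Y_∞ / 𝔼_ρ[Y₀]` with respect to `ℙ_ρ` (meaningful when
`𝔼_ρ[Y₀] > 0`; it is the zero measure when `𝔼_ρ[Y₀] = 0`). -/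
noncomputable def absorptionMeasure (q : HOQRW d H) (ρ : q.DiagonalState) (W : Submodule ℂ H) :
    Measure q.Path :=
  (q.trajectoryMeasure ρ).withDensity fun ω =>
    ENNReal.ofReal (q.absorbedMassLimit ρ W ω / q.absorptionWeight ρ W)

end Trajectories

end HOQRW

end OpenQuantumWalk

set_option linter.unusedSectionVars false

namespace OpenQuantumWalk

/-! ## Fixed points and monotone limits -/

-- The Kraus operators leave an enclosure `W` invariant, so `p_W ≤ 𝔏*(p_W)`. The iterates `𝔏*ⁿ(p_W)`
-- therefore increase below `1` and converge to a harmonic operator, `𝔏*(A(W)) = A(W)`, with `p_W ≤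
-- A(W) ≤ 1`.
--
-- For harmonic `0 ≤ a ≤ 1` the process `Tr(a ρₙ)` is a bounded martingale. The mass of a cylinder
-- of length `n` is the trace of the unnormalised state `σₙ`, so the integral of `Tr(a ρₙ)` over it
-- is `Tr(a σₙ)`; summing over the next shift gives `Tr(a 𝔏(σₙ)) = Tr(𝔏*(a) σₙ) = Tr(a σₙ)`.
-- Martingale convergence yields `Y_∞`, and dominated convergence shows that `Y_∞` closes the
-- martingale (`setLIntegral_absorbedMassLimit`). This gives the density on each `ℱₙ` and the total
-- mass of the component measures.
--
-- The convex decompositions rest on `∑ A(Wᵢ) = 1` for mutually orthogonal enclosures spanning `R`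
-- (`sum_absorption_eq_one`). The sum `B` is harmonic with `p_R ≤ B ≤ 1`, so `1 - B` is positive,
-- harmonic and zero on `R`. Such an operator `a` must vanish (`eq_zero_of_harmonic`): if `a ≠ 0`,
-- then `‖a‖ - a` is again positive and harmonic, its nonzero kernel is invariant under the Kraus
-- operators, and a fixed point argument puts an invariant state there. The support of that state
-- lies in `R`, where `a` is both `0` and `‖a‖`. Hence the limits `Y_∞` sum to one almost surely,
-- and the component measures recombine to `ℙ_ρ`.

/-- A continuous linear map that preserves a nonempty compact convex set has a fixed point in it. -/
theorem exists_fixedPoint_of_isCompact_convex {F : Type*} [NormedAddCommGroup F] [NormedSpace ℝ F]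
    {K : Set F} (hK : IsCompact K) (hconv : Convex ℝ K) (hne : K.Nonempty) (T : F →L[ℝ] F)
    (hT : Set.MapsTo T K K) : ∃ x ∈ K, T x = x := by
  obtain ⟨x, hx⟩ := hne
  have hiter : ∀ n : ℕ, T^[n] x ∈ K := fun n => hT.iterate n hx
  -- The shift to `n + 1` matters: the empty average is `0`, which need not lie in `K`.
  have hmem : ∀ n : ℕ, birkhoffAverage ℝ T id (n + 1) x ∈ K := by
    intro n
    rw [birkhoffAverage, birkhoffSum, Finset.smul_sum]
    refine hconv.sum_mem (fun _ _ => by positivity) ?_ (fun i _ => hiter i)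
    rw [Finset.sum_const, Finset.card_range, nsmul_eq_mul]
    exact mul_inv_cancel₀ (by positivity)
  obtain ⟨a, ha, φ, hφ, hlim⟩ := hK.tendsto_subseq hmem
  refine ⟨a, ha, ?_⟩
  -- The two averages differ by `(Tⁿ x - x) / n`, which tends to zero because the orbit is bounded.
  have h0 : Tendsto (fun n => birkhoffAverage ℝ T id n (T x) - birkhoffAverage ℝ T id n x)
      atTop (𝓝 0) := by
    refine tendsto_birkhoffAverage_apply_sub_birkhoffAverage (𝕜 := ℝ)
      (hK.isBounded.subset ?_)
    rintro _ ⟨n, rfl⟩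
    exact hiter n
  have h1 : Tendsto (fun n => birkhoffAverage ℝ T id (φ n + 1) (T x)
      - birkhoffAverage ℝ T id (φ n + 1) x) atTop (𝓝 0) :=
    h0.comp ((tendsto_add_atTop_nat 1).comp hφ.tendsto_atTop)
  have h2 : ∀ n, birkhoffAverage ℝ T id n (T x) = T (birkhoffAverage ℝ T id n x) := by
    intro n
    simp only [birkhoffAverage, birkhoffSum, map_smul, map_sum, id]
    congr 1
    refine Finset.sum_congr rfl fun i _ => ?_
    rw [← Function.iterate_succ_apply, Function.iterate_succ_apply']
  simp only [h2] at h1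
  have h3 := ((T.continuous.tendsto a).comp hlim).sub hlim
  exact sub_eq_zero.1 (tendsto_nhds_unique h3 h1)

section Operators

variable {H : Type*} [NormedAddCommGroup H] [InnerProductSpace ℂ H] [CompleteSpace H]
  [FiniteDimensional ℂ H]

theorem norm_le_one_of_nonneg_of_le_one {a : H →L[ℂ] H} (h0 : 0 ≤ a) (h1 : a ≤ 1) : ‖a‖ ≤ 1 :=
  (CStarAlgebra.norm_le_norm_of_nonneg_of_le h0 h1).trans ContinuousLinearMap.norm_id_le

/-- A monotone sequence of operators between `0` and `1` converges. -/
theorem exists_tendsto_of_monotone_of_le_one {a : ℕ → H →L[ℂ] H} (hm : Monotone a)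
    (h0 : ∀ n, 0 ≤ a n) (h1 : ∀ n, a n ≤ 1) : ∃ b, Tendsto a atTop (𝓝 b) := by
  have : ProperSpace (H →L[ℂ] H) := FiniteDimensional.proper ℂ _
  obtain ⟨b, -, φ, hφ, hlim⟩ := tendsto_subseq_of_bounded
    (Metric.isBounded_closedBall (x := (0 : H →L[ℂ] H)) (r := 1)) (x := a) fun n => by
      simpa using norm_le_one_of_nonneg_of_le_one (h0 n) (h1 n)
  have hle : ∀ n, a n ≤ b := fun n =>
    ge_of_tendsto hlim <| by
      filter_upwards [eventually_ge_atTop n] with k hk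
      exact hm (hk.trans (hφ.id_le k))
  refine ⟨b, ?_⟩
  -- The subsequential limit bounds every `a n`, so the distance to it decreases and convergence
  -- along a subsequence suffices.
  have hanti : Antitone fun n => ‖a n - b‖ := by
    intro n m hnm
    simp only
    rw [norm_sub_rev (a m), norm_sub_rev (a n)]
    exact CStarAlgebra.norm_le_norm_of_nonneg_of_le (sub_nonneg.2 (hle m))
      (sub_le_sub_left (hm hnm) b)
  rw [tendsto_iff_norm_sub_tendsto_zero]
  refine (tendsto_iff_tendsto_subseq_of_antitone hanti hφ.tendsto_atTop).2 ?_
  exact tendsto_iff_norm_sub_tendsto_zero.1 hlim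

/-! ## Positive operators, supports and the trace -/

/-- Writing `a = ∑ |uᵢ⟩⟨uᵢ|` turns `⟨x, a x⟩` into `∑ |⟨uᵢ, x⟩|²`, so every coefficient of `a x`
vanishes. -/
theorem apply_eq_zero_of_inner_self_eq_zero {a : H →L[ℂ] H} (ha : 0 ≤ a) {x : H}
    (hx : inner ℂ x (a x) = 0) : a x = 0 := by
  obtain ⟨m, u, rfl⟩ := ContinuousLinearMap.isPositive_iff_eq_sum_rankOne.1
    ((ContinuousLinearMap.nonneg_iff_isPositive a).1 ha)
  simp only [sum_apply, InnerProductSpace.rankOne_apply, inner_sum,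
    inner_smul_right] at hx ⊢
  have h1 : ∑ i, ‖inner ℂ (u i) x‖ ^ 2 = 0 := by
    have h2 : ∀ i, inner ℂ (u i) x * inner ℂ x (u i) = ((‖inner ℂ (u i) x‖ ^ 2 : ℝ) : ℂ) := by
      intro i
      rw [← inner_conj_symm x (u i), Complex.mul_conj, Complex.normSq_eq_norm_sq]
    simp only [h2] at hx
    exact_mod_cast hx
  refine Finset.sum_eq_zero fun i _ => ?_
  have h3 := (Finset.sum_eq_zero_iff_of_nonneg fun i _ => sq_nonneg _).1 h1 i (Finset.mem_univ i)
  rw [norm_eq_zero.1 (pow_eq_zero_iff two_ne_zero |>.1 h3), zero_smul]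

theorem re_inner_le_of_le {a b : H →L[ℂ] H} (h : a ≤ b) (x : H) :
    (inner ℂ x (a x)).re ≤ (inner ℂ x (b x)).re := by
  have h1 := ((ContinuousLinearMap.le_def a b).1 h).re_inner_nonneg_right x
  simp only [sub_apply, inner_sub_right, map_sub, RCLike.re_eq_complex_re] at h1
  linarith

theorem tr_mul_comm (a b : H →L[ℂ] H) : tr (a * b) = tr (b * a) :=
  LinearMap.trace_mul_comm ℂ (a : H →ₗ[ℂ] H) (b : H →ₗ[ℂ] H)

/-- The trace as a continuous linear functional. -/
noncomputable def trCLM : (H →L[ℂ] H) →L[ℂ] ℂ :=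
  LinearMap.toContinuousLinearMap
    { toFun := tr
      map_add' := fun a b => by simp [tr]
      map_smul' := fun c a => by simp [tr] }

theorem tr_add (a b : H →L[ℂ] H) : tr (a + b) = tr a + tr b := trCLM.map_add a b
theorem tr_sub (a b : H →L[ℂ] H) : tr (a - b) = tr a - tr b := trCLM.map_sub a b
theorem tr_smul (c : ℂ) (a : H →L[ℂ] H) : tr (c • a) = c * tr a := trCLM.map_smul c a
theorem tr_sum {ι : Type*} (s : Finset ι) (a : ι → H →L[ℂ] H) :
    tr (∑ i ∈ s, a i) = ∑ i ∈ s, tr (a i) := map_sum trCLM a s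

/-- In a decomposition `a = ∑ |uᵢ⟩⟨uᵢ|` each summand has norm and trace both equal to `‖uᵢ‖²`. Hence
states form a bounded set, and a positive operator of trace zero is zero. -/
theorem norm_le_re_tr {a : H →L[ℂ] H} (ha : 0 ≤ a) : ‖a‖ ≤ (tr a).re := by
  obtain ⟨m, u, rfl⟩ := ContinuousLinearMap.isPositive_iff_eq_sum_rankOne.1
    ((ContinuousLinearMap.nonneg_iff_isPositive a).1 ha)
  rw [tr_sum, Complex.re_sum]
  refine (norm_sum_le _ _).trans (Finset.sum_le_sum fun i _ => ?_)
  rw [tr, InnerProductSpace.trace_rankOne, InnerProductSpace.norm_rankOne]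
  rw [← sq, ← inner_self_eq_norm_sq (𝕜 := ℂ)]
  rfl

open scoped ComplexOrder in
theorem im_tr_eq_zero {a : H →L[ℂ] H} (ha : 0 ≤ a) : (tr a).im = 0 :=
  (Complex.nonneg_iff.1 (LinearMap.IsPositive.trace_nonneg
    ((ContinuousLinearMap.isPositive_toLinearMap_iff a).2
      ((ContinuousLinearMap.nonneg_iff_isPositive a).1 ha)))).2.symm

theorem tr_eq_ofReal_re {a : H →L[ℂ] H} (ha : 0 ≤ a) : tr a = ((tr a).re : ℂ) :=
  Complex.ext rfl (by simp [im_tr_eq_zero ha])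

theorem eq_zero_of_tr_eq_zero {a : H →L[ℂ] H} (ha : 0 ≤ a) (h : tr a = 0) : a = 0 := by
  have := norm_le_re_tr ha
  rw [h] at this
  exact norm_le_zero_iff.1 this

/-- `Tr(a b)` is real and nonnegative for positive `a` and `b`. -/
theorem exists_nonneg_tr_mul_eq {a b : H →L[ℂ] H} (ha : 0 ≤ a) (hb : 0 ≤ b) :
    ∃ c : H →L[ℂ] H, 0 ≤ c ∧ tr (a * b) = tr c := by
  obtain ⟨s, rfl⟩ := CStarAlgebra.nonneg_iff_eq_star_mul_self.1 ha
  refine ⟨s * b * star s, star_right_conjugate_nonneg hb s, ?_⟩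
  rw [mul_assoc, tr_mul_comm, mul_assoc]

theorem re_tr_mul_nonneg {a b : H →L[ℂ] H} (ha : 0 ≤ a) (hb : 0 ≤ b) : 0 ≤ (tr (a * b)).re := by
  obtain ⟨c, hc, h⟩ := exists_nonneg_tr_mul_eq ha hb
  rw [h]
  exact re_tr_nonneg ((ContinuousLinearMap.nonneg_iff_isPositive c).1 hc)

theorem tr_mul_eq_ofReal_re {a b : H →L[ℂ] H} (ha : 0 ≤ a) (hb : 0 ≤ b) :
    tr (a * b) = ((tr (a * b)).re : ℂ) := by
  obtain ⟨c, hc, h⟩ := exists_nonneg_tr_mul_eq ha hb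
  rw [h]
  exact tr_eq_ofReal_re hc

theorem re_tr_mul_le {a b : H →L[ℂ] H} (ha : a ≤ 1) (hb : 0 ≤ b) :
    (tr (a * b)).re ≤ (tr b).re := by
  have h := re_tr_mul_nonneg (sub_nonneg.2 ha) hb
  rw [sub_mul, one_mul, tr_sub, Complex.sub_re] at h
  linarith

theorem supp_le_iff {a : H →L[ℂ] H} {W : Submodule ℂ H} :
    supp a ≤ W ↔ ∀ y ∈ Wᗮ, a y = 0 := by
  rw [supp, Submodule.orthogonal_le_iff_orthogonal_le]
  rfl

theorem supp_ne_bot {a : H →L[ℂ] H} (ha : a ≠ 0) : supp a ≠ ⊥ := by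
  intro h
  refine ha (ContinuousLinearMap.ext fun x => ?_)
  exact supp_le_iff.1 h.le x (by simp)

end Operators

end OpenQuantumWalk
namespace OpenQuantumWalk

namespace HOQRW

variable {d : ℕ} {H : Type*} [NormedAddCommGroup H] [InnerProductSpace ℂ H] [CompleteSpace H]
  [FiniteDimensional ℂ H]

/-! ## Enclosures and absorption operators -/

theorem localChannel_apply (q : HOQRW d H) (a : H →L[ℂ] H) :
    q.localChannel a = ∑ j, q.L j * a * star (q.L j) := rfl

theorem dualChannel_apply (q : HOQRW d H) (a : H →L[ℂ] H) :
    q.dualChannel a = ∑ j, star (q.L j) * a * q.L j := rfl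

theorem localChannel_nonneg (q : HOQRW d H) {a : H →L[ℂ] H} (ha : 0 ≤ a) :
    0 ≤ q.localChannel a :=
  Finset.sum_nonneg fun j _ => star_right_conjugate_nonneg ha (q.L j)

theorem dualChannel_nonneg (q : HOQRW d H) {a : H →L[ℂ] H} (ha : 0 ≤ a) :
    0 ≤ q.dualChannel a :=
  Finset.sum_nonneg fun j _ => star_left_conjugate_nonneg ha (q.L j)

theorem dualChannel_one (q : HOQRW d H) : q.dualChannel 1 = 1 := by
  simpa [dualChannel] using q.kraus

theorem dualChannel_mono (q : HOQRW d H) : Monotone q.dualChannel := by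
  intro a b hab
  have h := q.dualChannel_nonneg (sub_nonneg.2 hab)
  rwa [map_sub, sub_nonneg] at h

theorem dualChannel_pow_mono (q : HOQRW d H) (n : ℕ) : Monotone (q.dualChannel ^ n) := by
  rw [Module.End.coe_pow]
  exact q.dualChannel_mono.iterate n

theorem dualChannel_pow_one (q : HOQRW d H) (n : ℕ) : (q.dualChannel ^ n) 1 = 1 := by
  rw [Module.End.coe_pow]
  exact Function.iterate_fixed q.dualChannel_one n

/-- The Kraus operators leave every enclosure invariant. -/
theorem L_apply_mem_of_isEnclosure (q : HOQRW d H) {W : Submodule ℂ H}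
    (hW : IsEnclosure q.localChannel W) (j : Fin q.v) {x : H} (hx : x ∈ W) : q.L j x ∈ W := by
  -- The enclosure is tested on `|x⟩⟨x|`. Pairing `𝔏(|x⟩⟨x|) y = 0` with `y ∈ Wᗮ` gives `∑ |⟨Lᵢ x,
  -- y⟩|² = 0`.
  have h1 := hW (InnerProductSpace.rankOne ℂ x x) (InnerProductSpace.isPositive_rankOne_self x) <|
    supp_le_iff.2 fun y hy => by
      rw [InnerProductSpace.rankOne_apply, (Submodule.mem_orthogonal W y).1 hy x hx, zero_smul]
  rw [supp_le_iff] at h1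
  rw [← Submodule.orthogonal_orthogonal W, Submodule.mem_orthogonal']
  intro y hy
  have h2 := congrArg (fun z => inner ℂ y z) (h1 y hy)
  simp only [localChannel_apply, sum_apply, mul_apply_eq_comp,
    InnerProductSpace.rankOne_apply, map_smul, inner_sum, inner_smul_right, inner_zero_right,
    ContinuousLinearMap.star_eq_adjoint, ContinuousLinearMap.adjoint_inner_right] at h2
  have h3 : ∀ i, inner ℂ (q.L i x) y * inner ℂ y (q.L i x)
      = ((‖inner ℂ (q.L i x) y‖ ^ 2 : ℝ) : ℂ) := by
    intro i
    rw [← inner_conj_symm y, Complex.mul_conj, Complex.normSq_eq_norm_sq]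
  simp only [h3] at h2
  have h4 : ∑ i, ‖inner ℂ (q.L i x) y‖ ^ 2 = 0 := by exact_mod_cast h2
  have h5 := (Finset.sum_eq_zero_iff_of_nonneg fun i _ => sq_nonneg _).1 h4 j (Finset.mem_univ j)
  exact norm_eq_zero.1 (pow_eq_zero_iff two_ne_zero |>.1 h5)

/-- The projection onto an enclosure is subharmonic. -/
theorem starProjection_le_dualChannel (q : HOQRW d H) {W : Submodule ℂ H}
    (hW : IsEnclosure q.localChannel W) :
    W.starProjection ≤ q.dualChannel W.starProjection := by
  set p := W.starProjection
  set X := q.dualChannel p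
  have hp : star p = p := isSelfAdjoint_starProjection W
  have hpp : p * p = p := W.isIdempotentElem_starProjection
  have hp0 : 0 ≤ p := by
    rw [← hpp]; nth_rw 1 [← hp]; exact star_mul_self_nonneg p
  -- On `W` the inner `p` in `∑ Lⱼ* p Lⱼ` acts trivially, and the Kraus relation remains.
  have hXp : X * p = p := by
    ext x
    have h1 : ∀ j, p (q.L j (p x)) = q.L j (p x) := fun j =>
      Submodule.starProjection_eq_self_iff.2
        (q.L_apply_mem_of_isEnclosure hW j (Submodule.starProjection_apply_mem W x))
    have h2 := congrArg (fun a : H →L[ℂ] H => a (p x)) q.kraus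
    simp only [sum_apply, mul_apply_eq_comp, one_apply_eq_self] at h2
    simp only [X, dualChannel_apply, sum_apply, mul_apply_eq_comp, h1]
    exact h2
  have hX : star X = X := IsSelfAdjoint.of_nonneg (q.dualChannel_nonneg hp0)
  have hpX : p * X = p := by
    have := congrArg star hXp
    rwa [star_mul, hX, hp] at this
  -- `X` is block diagonal for `W ⊕ Wᗮ` with block `1` on `W`, so `X - p` is the compression of `X ≥
  -- 0` to `Wᗮ`.
  have h := star_left_conjugate_nonneg (q.dualChannel_nonneg hp0) (1 - p)
  have h' : star (1 - p) * X * (1 - p) = X - p := by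
    rw [star_sub, star_one, hp, sub_mul, one_mul, hpX, mul_sub, mul_one, sub_mul, hXp, hpp]
    abel
  rw [← sub_nonneg, ← h']
  exact h

theorem starProjection_nonneg (W : Submodule ℂ H) : 0 ≤ W.starProjection :=
  (ContinuousLinearMap.nonneg_iff_isPositive _).2
    (ContinuousLinearMap.IsPositive.of_isStarProjection isStarProjection_starProjection)

theorem starProjection_le_one (W : Submodule ℂ H) : W.starProjection ≤ 1 := by
  have h := starProjection_nonneg Wᗮ
  rw [Submodule.starProjection_orthogonal'] at h
  exact sub_nonneg.1 h

/-- The limit defining the absorption operator of an enclosure exists. -/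
theorem tendsto_absorption (q : HOQRW d H) {W : Submodule ℂ H}
    (hW : IsEnclosure q.localChannel W) :
    Tendsto (fun n : ℕ => (q.dualChannel ^ n) W.starProjection) atTop (𝓝 (q.absorption W)) := by
  refine tendsto_nhds_limUnder (exists_tendsto_of_monotone_of_le_one ?_ ?_ ?_)
  · refine monotone_nat_of_le_succ fun n => ?_
    rw [pow_succ, Module.End.mul_apply]
    exact q.dualChannel_pow_mono n (q.starProjection_le_dualChannel hW)
  · intro n
    simpa using q.dualChannel_pow_mono n (starProjection_nonneg W)
  · intro n
    simpa [dualChannel_pow_one] using q.dualChannel_pow_mono n (starProjection_le_one W)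

theorem starProjection_le_absorption (q : HOQRW d H) {W : Submodule ℂ H}
    (hW : IsEnclosure q.localChannel W) : W.starProjection ≤ q.absorption W := by
  refine ge_of_tendsto' (q.tendsto_absorption hW) fun n => ?_
  induction n with
  | zero => simp
  | succ n ih =>
    rw [pow_succ, Module.End.mul_apply]
    exact ih.trans (q.dualChannel_pow_mono n (q.starProjection_le_dualChannel hW))

theorem absorption_nonneg (q : HOQRW d H) {W : Submodule ℂ H}
    (hW : IsEnclosure q.localChannel W) : 0 ≤ q.absorption W :=
  (starProjection_nonneg W).trans (q.starProjection_le_absorption hW)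

theorem absorption_le_one (q : HOQRW d H) {W : Submodule ℂ H}
    (hW : IsEnclosure q.localChannel W) : q.absorption W ≤ 1 :=
  le_of_tendsto' (q.tendsto_absorption hW) fun n => by
    simpa [dualChannel_pow_one] using q.dualChannel_pow_mono n (starProjection_le_one W)

/-- Absorption operators are harmonic. -/
theorem dualChannel_absorption (q : HOQRW d H) {W : Submodule ℂ H}
    (hW : IsEnclosure q.localChannel W) : q.dualChannel (q.absorption W) = q.absorption W := by
  have h1 := (q.dualChannel.continuous_of_finiteDimensional.tendsto _).comp
    (q.tendsto_absorption hW)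
  have h2 := (q.tendsto_absorption hW).comp (tendsto_add_atTop_nat 1)
  refine tendsto_nhds_unique h1 (h2.congr fun n => ?_)
  simp only [Function.comp_apply, pow_succ', Module.End.mul_apply]

/-! ## The fast recurrent space absorbs -/

/-- The kernel of a positive harmonic operator is invariant under the Kraus operators. -/
theorem apply_L_eq_zero_of_harmonic (q : HOQRW d H) {c : H →L[ℂ] H} (hc : 0 ≤ c)
    (hfix : q.dualChannel c = c) {x : H} (hx : c x = 0) (j : Fin q.v) : c (q.L j x) = 0 := by
  refine apply_eq_zero_of_inner_self_eq_zero hc ?_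
  have hpos := (ContinuousLinearMap.nonneg_iff_isPositive c).1 hc
  -- By harmonicity this sum of nonnegative terms is `⟨x, c x⟩ = 0`.
  have h1 : ∑ i, inner ℂ (q.L i x) (c (q.L i x)) = 0 := by
    have h2 := congrArg (fun a : H →L[ℂ] H => inner ℂ x (a x)) hfix
    simp only [dualChannel_apply, sum_apply, mul_apply_eq_comp, inner_sum, hx,
      inner_zero_right, ContinuousLinearMap.star_eq_adjoint,
      ContinuousLinearMap.adjoint_inner_right] at h2
    exact h2
  open scoped ComplexOrder in
  exact (Finset.sum_eq_zero_iff_of_nonneg fun i _ => hpos.inner_nonneg_right (q.L i x)).1 h1 j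
    (Finset.mem_univ j)

/-- A nonzero subspace that is invariant under the Kraus operators supports an invariant state. -/
theorem exists_invariant_state (q : HOQRW d H) {E : Submodule ℂ H} (hE : E ≠ ⊥)
    (hinv : ∀ j, ∀ x ∈ E, q.L j x ∈ E) :
    ∃ ω : H →L[ℂ] H, ω.IsPositive ∧ tr ω = 1 ∧ q.localChannel ω = ω ∧ supp ω ≤ E := by
  have : ProperSpace (H →L[ℂ] H) := FiniteDimensional.proper ℂ _
  -- The states supported in `E`: a compact convex set in which the fixed point is sought.
  let K : Set (H →L[ℂ] H) := {ω | 0 ≤ ω ∧ tr ω = 1 ∧ ∀ y ∈ Eᗮ, ω y = 0}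
  have hclosed : IsClosed K := by
    refine CStarAlgebra.isClosed_nonneg.inter (IsClosed.inter ?_ ?_)
    · exact isClosed_eq trCLM.continuous continuous_const
    · have : {ω : H →L[ℂ] H | ∀ y ∈ Eᗮ, ω y = 0} = ⋂ y ∈ Eᗮ, {ω | ω y = 0} := by
        ext; simp
      change IsClosed {ω : H →L[ℂ] H | ∀ y ∈ Eᗮ, ω y = 0}
      rw [this]
      exact isClosed_biInter fun y _ => isClosed_eq (by fun_prop) continuous_const
  have hbdd : K ⊆ Metric.closedBall 0 1 := by
    rintro ω ⟨h0, h1, -⟩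
    have := norm_le_re_tr h0
    rw [h1] at this
    simpa using this
  have hcomp : IsCompact K := (isCompact_closedBall 0 1).of_isClosed_subset hclosed hbdd
  have hconv : Convex ℝ K := by
    rintro ω ⟨h0, h1, h2⟩ τ ⟨k0, k1, k2⟩ a b ha hb hab
    refine ⟨add_nonneg (smul_nonneg ha h0) (smul_nonneg hb k0), ?_, fun y hy => ?_⟩
    · rw [← Complex.coe_smul a, ← Complex.coe_smul b, tr_add, tr_smul, tr_smul, h1, k1, mul_one,
        mul_one]
      exact_mod_cast hab
    · simp [h2 y hy, k2 y hy]
  have hne : K.Nonempty := by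
    obtain ⟨e, he, he0⟩ := E.exists_mem_ne_zero_of_ne_bot hE
    refine ⟨(inner ℂ e e)⁻¹ • InnerProductSpace.rankOne ℂ e e, ?_, ?_, fun y hy => ?_⟩
    · rw [ContinuousLinearMap.nonneg_iff_isPositive]
      open scoped ComplexOrder in
      exact (InnerProductSpace.isPositive_rankOne_self e).smul_of_nonneg
        (inv_nonneg.2 (by
          rw [inner_self_eq_norm_sq_to_K, ← RCLike.ofReal_pow]
          exact RCLike.ofReal_nonneg.2 (sq_nonneg ‖e‖)))
    · rw [tr_smul, tr, InnerProductSpace.trace_rankOne]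
      exact inv_mul_cancel₀ (inner_self_ne_zero.2 he0)
    · simp [(Submodule.mem_orthogonal E y).1 hy e he]
  have hmaps : Set.MapsTo q.localChannel K K := by
    rintro ω ⟨h0, h1, h2⟩
    refine ⟨q.localChannel_nonneg h0, (q.tr_localChannel ω).trans h1, fun y hy => ?_⟩
    simp only [localChannel_apply, sum_apply, mul_apply_eq_comp]
    refine Finset.sum_eq_zero fun j _ => ?_
    -- Since `Lⱼ` preserves `E`, its adjoint preserves `Eᗮ`.
    rw [h2, map_zero]
    rw [Submodule.mem_orthogonal] at hy ⊢
    intro x hx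
    rw [ContinuousLinearMap.star_eq_adjoint, ContinuousLinearMap.adjoint_inner_right]
    exact hy _ (hinv j x hx)
  obtain ⟨ω, ⟨h0, h1, h2⟩, hfix⟩ := exists_fixedPoint_of_isCompact_convex hcomp hconv hne
    ((LinearMap.toContinuousLinearMap q.localChannel).restrictScalars ℝ) hmaps
  exact ⟨ω, (ContinuousLinearMap.nonneg_iff_isPositive ω).1 h0, h1, hfix, supp_le_iff.2 h2⟩

theorem supp_le_recurrentSpace {Φ : (H →L[ℂ] H) →ₗ[ℂ] (H →L[ℂ] H)} {ω : H →L[ℂ] H}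
    (hω : ω.IsPositive) (h1 : tr ω = 1) (hfix : Φ ω = ω) : supp ω ≤ recurrentSpace Φ :=
  le_sSup ⟨ω, hω, h1, hfix, rfl⟩

/-- A positive harmonic operator that vanishes on the fast recurrent space is zero. -/
theorem eq_zero_of_harmonic (q : HOQRW d H) {a : H →L[ℂ] H} (ha : 0 ≤ a)
    (hfix : q.dualChannel a = a) (hR : ∀ x ∈ recurrentSpace q.localChannel, a x = 0) : a = 0 := by
  by_contra hne
  have hnt : Nontrivial (H →L[ℂ] H) := ⟨⟨a, 0, hne⟩⟩
  -- Its kernel is the eigenspace of `a` for the eigenvalue `‖a‖`; subtracting from a scalar keeps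
  -- harmonicity because `𝔏*(1) = 1`.
  let c : H →L[ℂ] H := algebraMap ℝ (H →L[ℂ] H) ‖a‖ - a
  have hcx : ∀ x, c x = ‖a‖ • x - a x := fun x => by
    simp [c, Algebra.algebraMap_eq_smul_one]
  have hc : 0 ≤ c :=
    sub_nonneg.2 (IsSelfAdjoint.le_algebraMap_norm_self (IsSelfAdjoint.of_nonneg ha))
  have hcfix : q.dualChannel c = c := by
    simp only [c, Algebra.algebraMap_eq_smul_one, ← Complex.coe_smul, map_sub, map_smul,
      q.dualChannel_one, hfix]
  let E : Submodule ℂ H := LinearMap.ker (c : H →ₗ[ℂ] H)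
  have hE : E ≠ ⊥ := by
    intro hbot
    -- `‖a‖` lies in the spectrum of `a ≥ 0`, whereas in finite dimension an injective `c` would be
    -- invertible.
    have hspec := CStarAlgebra.norm_mem_spectrum_of_nonneg (a := a) ha
    rw [spectrum.mem_iff] at hspec
    refine hspec ?_
    have hinj : Function.Injective (c : H →ₗ[ℂ] H) := LinearMap.ker_eq_bot.1 hbot
    exact ContinuousLinearMap.isUnit_iff_bijective.2
      ⟨hinj, LinearMap.injective_iff_surjective.1 hinj⟩
  obtain ⟨ω, hω, h1, hωfix, hs⟩ := q.exists_invariant_state hE fun j x hx =>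
    q.apply_L_eq_zero_of_harmonic hc hcfix hx j
  have hω0 : ω ≠ 0 := by
    rintro rfl
    simp [tr] at h1
  obtain ⟨x, hx, hx0⟩ := (supp ω).exists_mem_ne_zero_of_ne_bot (supp_ne_bot hω0)
  have h2 : c x = 0 := hs hx
  rw [hcx, hR x (supp_le_recurrentSpace hω h1 hωfix hx), sub_zero] at h2
  rcases smul_eq_zero.1 h2 with h | h
  · exact hne (norm_eq_zero.1 h)
  · exact hx0 h

/-- The absorption operators of mutually orthogonal enclosures spanning the fast recurrent space
sum to the identity. -/
theorem sum_absorption_eq_one (q : HOQRW d H) {ι : Type*} [Fintype ι] {W : ι → Submodule ℂ H}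
    (hW : ∀ i, IsEnclosure q.localChannel (W i)) (horth : ∀ i j, i ≠ j → W i ⟂ W j)
    (hsup : ⨆ i, W i = recurrentSpace q.localChannel) : ∑ i, q.absorption (W i) = 1 := by
  set R := recurrentSpace q.localChannel
  have hfam : OrthogonalFamily ℂ (fun i => W i) fun i => (W i).subtypeₗᵢ :=
    OrthogonalFamily.of_pairwise fun i j hij => horth i j hij
  have hproj : ∑ i, (W i).starProjection = R.starProjection := by
    ext x
    obtain ⟨y, hy, z, hz, rfl⟩ := R.exists_add_mem_mem_orthogonal x
    have h1 : ∀ i, (W i).starProjection z = 0 := fun i =>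
      (Submodule.starProjection_apply_eq_zero_iff (W i)).2
        (Submodule.orthogonal_le (hsup ▸ le_iSup W i) hz)
    rw [map_add, map_add, Submodule.starProjection_eq_self_iff.2 hy,
      (Submodule.starProjection_apply_eq_zero_iff R).2 hz]
    simp only [sum_apply, h1, Finset.sum_const_zero, add_zero]
    exact hfam.sum_projection_of_mem_iSup y (hsup.symm ▸ hy)
  have hlim : Tendsto (fun n : ℕ => (q.dualChannel ^ n) R.starProjection) atTop
      (𝓝 (∑ i, q.absorption (W i))) := by
    rw [← hproj]
    simp only [map_sum]
    exact tendsto_finsetSum _ fun i _ => q.tendsto_absorption (hW i)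
  set B := ∑ i, q.absorption (W i)
  have hB1 : B ≤ 1 := le_of_tendsto' hlim fun n => by
    simpa [dualChannel_pow_one] using q.dualChannel_pow_mono n (starProjection_le_one R)
  have hRB : R.starProjection ≤ B := by
    rw [← hproj]
    exact Finset.sum_le_sum fun i _ => q.starProjection_le_absorption (hW i)
  have hBfix : q.dualChannel B = B := by
    simp only [B, map_sum, q.dualChannel_absorption (hW _)]
  refine (sub_eq_zero.1 (q.eq_zero_of_harmonic (sub_nonneg.2 hB1) ?_ fun x hx => ?_)).symm
  · rw [map_sub, q.dualChannel_one, hBfix]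
  · have h0 := sub_nonneg.2 hB1
    refine apply_eq_zero_of_inner_self_eq_zero h0 ?_
    -- For `x ∈ R`, `p_R ≤ B` gives `⟨x, B x⟩ ≥ ‖x‖²`.
    have hle : (inner ℂ x ((1 - B) x)).re ≤ 0 := by
      have := re_inner_le_of_le hRB x
      rw [Submodule.starProjection_eq_self_iff.2 hx] at this
      simp only [sub_apply, one_apply_eq_self, inner_sub_right, Complex.sub_re]
      linarith
    open scoped ComplexOrder in
    have hge := Complex.nonneg_iff.1
      (((ContinuousLinearMap.nonneg_iff_isPositive _).1 h0).inner_nonneg_right x)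
    exact Complex.ext (le_antisymm hle hge.1) hge.2.symm

end HOQRW

end OpenQuantumWalk
namespace OpenQuantumWalk

namespace HOQRW

variable {d : ℕ} {H : Type*} [NormedAddCommGroup H] [InnerProductSpace ℂ H] [CompleteSpace H]
  [FiniteDimensional ℂ H]

/-! ## The trajectory measure on cylinders -/

/-- Local finiteness exhausts the lattice by finite balls. Countably many histories make every
function of a history measurable and every `ℱₙ` event a countable union of cylinders. -/
instance (q : HOQRW d H) : Countable q.Site := by
  have h : {x | x ∈ q.lattice} = ⋃ n : ℕ, {x | x ∈ q.lattice ∧ ‖x‖ ≤ n} := by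
    ext x
    simp only [Set.mem_ofPred_eq, Set.mem_iUnion]
    exact ⟨fun hx => (exists_nat_ge ‖x‖).imp fun n hn => ⟨hx, hn⟩, fun ⟨_, hx, _⟩ => hx⟩
  have hc : {x | x ∈ q.lattice}.Countable := by
    rw [h]
    exact Set.countable_iUnion fun n => (q.locallyFinite n).countable
  exact hc.to_subtype

instance (q : HOQRW d H) : DiscreteMeasurableSpace q.Site := ⟨fun _ => trivial⟩

/-- The initial site and the first `n` shifts of a path. -/
def history (q : HOQRW d H) (n : ℕ) (ω : q.Path) : q.Site × (Fin n → Fin q.v) :=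
  (ω.1, fun i => ω.2 i)

theorem measurable_history (q : HOQRW d H) (n : ℕ) : Measurable (q.history n) := by
  unfold history
  fun_prop

theorem history_eq_iff (q : HOQRW d H) {n : ℕ} {ω ω' : q.Path} :
    q.history n ω = q.history n ω' ↔ ω.1 = ω'.1 ∧ ∀ i < n, ω.2 i = ω'.2 i := by
  simp only [history, Prod.mk.injEq, funext_iff]
  exact and_congr_right fun _ => ⟨fun h i hi => h ⟨i, hi⟩, fun h i => h i i.2⟩

/-- The unnormalised state after `n` steps of a path. -/
noncomputable def pathState (q : HOQRW d H) (ρ : q.DiagonalState) (n : ℕ) (ω : q.Path) :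
    H →L[ℂ] H :=
  q.evolve (ρ.block ω.1) ω.2 n

theorem pathState_succ (q : HOQRW d H) (ρ : q.DiagonalState) (n : ℕ) (ω : q.Path) :
    q.pathState ρ (n + 1) ω = q.L (ω.2 n) * q.pathState ρ n ω * star (q.L (ω.2 n)) := rfl

theorem pathState_congr (q : HOQRW d H) (ρ : q.DiagonalState) {n : ℕ} {ω ω' : q.Path}
    (h : q.history n ω = q.history n ω') : q.pathState ρ n ω = q.pathState ρ n ω' := by
  obtain ⟨h1, h2⟩ := q.history_eq_iff.1 h
  rw [pathState, pathState, h1]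
  exact q.evolve_congr _ _ _ _ h2

theorem pathState_nonneg (q : HOQRW d H) (ρ : q.DiagonalState) (n : ℕ) (ω : q.Path) :
    0 ≤ q.pathState ρ n ω :=
  (ContinuousLinearMap.nonneg_iff_isPositive _).2 (q.evolve_isPositive (ρ.positive _) _ _)

/-- The internal state is the normalised path state. -/
theorem internalState_eq (q : HOQRW d H) (ρ : q.DiagonalState) (n : ℕ) (ω : q.Path) :
    q.internalState ρ n ω = (tr (q.pathState ρ n ω))⁻¹ • q.pathState ρ n ω := by
  induction n with
  | zero => rfl
  | succ n ih =>
    rw [internalState, ih, mul_smul_comm, smul_mul_assoc, ← pathState_succ, tr_smul, smul_smul]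
    -- A path state of trace zero is zero, so both sides vanish under `0⁻¹ = 0`.
    by_cases h : tr (q.pathState ρ n ω) = 0
    · rw [pathState_succ, eq_zero_of_tr_eq_zero (q.pathState_nonneg ρ n ω) h]
      simp
    · congr 1
      field_simp

theorem internalState_congr (q : HOQRW d H) (ρ : q.DiagonalState) {n : ℕ} {ω ω' : q.Path}
    (h : q.history n ω = q.history n ω') : q.internalState ρ n ω = q.internalState ρ n ω' := by
  rw [internalState_eq, internalState_eq, q.pathState_congr ρ h]

theorem internalState_nonneg (q : HOQRW d H) (ρ : q.DiagonalState) (n : ℕ) (ω : q.Path) :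
    0 ≤ q.internalState ρ n ω := by
  rw [internalState_eq, tr_eq_ofReal_re (q.pathState_nonneg ρ n ω), ← Complex.ofReal_inv,
    Complex.coe_smul]
  exact smul_nonneg (inv_nonneg.2 (re_tr_nonneg
    ((ContinuousLinearMap.nonneg_iff_isPositive _).1 (q.pathState_nonneg ρ n ω))))
    (q.pathState_nonneg ρ n ω)

theorem re_tr_internalState_le_one (q : HOQRW d H) (ρ : q.DiagonalState) (n : ℕ) (ω : q.Path) :
    (tr (q.internalState ρ n ω)).re ≤ 1 := by
  rw [internalState_eq, tr_smul]
  by_cases h : tr (q.pathState ρ n ω) = 0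
  · simp [h]
  · rw [inv_mul_cancel₀ h, Complex.one_re]

/-- The real random variable `Tr(a ρₙ)`. -/
noncomputable def expectation (q : HOQRW d H) (ρ : q.DiagonalState) (a : H →L[ℂ] H)
    (n : ℕ) (ω : q.Path) : ℝ :=
  (tr (a * q.internalState ρ n ω)).re

-- The martingale of a harmonic operator

section Expectation

variable (q : HOQRW d H) (ρ : q.DiagonalState) {a : H →L[ℂ] H}

theorem expectation_congr (a : H →L[ℂ] H) {n : ℕ} {ω ω' : q.Path}
    (h : q.history n ω = q.history n ω') : q.expectation ρ a n ω = q.expectation ρ a n ω' := by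
  rw [expectation, expectation, q.internalState_congr ρ h]

theorem expectation_nonneg (ha : 0 ≤ a) (n : ℕ) (ω : q.Path) : 0 ≤ q.expectation ρ a n ω :=
  re_tr_mul_nonneg ha (q.internalState_nonneg ρ n ω)

theorem expectation_le_one (ha : a ≤ 1) (n : ℕ) (ω : q.Path) : q.expectation ρ a n ω ≤ 1 :=
  (re_tr_mul_le ha (q.internalState_nonneg ρ n ω)).trans (q.re_tr_internalState_le_one ρ n ω)

/-- The normalisation of `ρₙ` cancels against the mass of the cylinder, leaving an expression linear
in the unnormalised state. -/
theorem expectation_mul_re_tr (a : H →L[ℂ] H) (n : ℕ) (ω : q.Path) :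
    q.expectation ρ a n ω * (tr (q.pathState ρ n ω)).re = (tr (a * q.pathState ρ n ω)).re := by
  have h0 := q.pathState_nonneg ρ n ω
  rw [expectation, internalState_eq, mul_smul_comm, tr_smul]
  by_cases h : tr (q.pathState ρ n ω) = 0
  · rw [eq_zero_of_tr_eq_zero h0 h]
    simp [tr]
  · rw [← Complex.re_mul_ofReal, ← tr_eq_ofReal_re h0]
    congr 1
    field_simp

/-- Without shifts the Kraus relation reads `0 = 1`, so all traces vanish, against total trace one.
A shift is needed to extend finite histories to paths. -/
theorem nonempty_fin (ρ : q.DiagonalState) : Nonempty (Fin q.v) := by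
  by_contra hv
  have := not_nonempty_iff.1 hv
  have h1 : (0 : H →L[ℂ] H) = 1 := by simpa using q.kraus
  have h2 : ∀ k, tr (ρ.block k) = 0 := fun k => by
    rw [← mul_one (ρ.block k), ← h1, mul_zero]
    simp [tr]
  have h3 := ρ.hasSum_tr
  simp only [h2] at h3
  exact zero_ne_one (hasSum_zero.unique h3)

theorem history_surjective (ρ : q.DiagonalState) (n : ℕ) : Function.Surjective (q.history n) := by
  obtain ⟨j⟩ := q.nonempty_fin ρ
  rintro ⟨k, u⟩
  exact ⟨(k, fun i => if h : i < n then u ⟨i, h⟩ else j), by simp [history]⟩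

theorem trajectoryMeasure_history_fibre (n : ℕ) (ω : q.Path) :
    q.trajectoryMeasure ρ (q.history n ⁻¹' {q.history n ω})
      = ENNReal.ofReal (tr (q.pathState ρ n ω)).re := by
  rw [pathState, ← q.trajectoryMeasure_cylinder ρ ω.1 n ω.2]
  congr 1
  ext ω'
  exact q.history_eq_iff

theorem setLIntegral_expectation_history_fibre (ha : 0 ≤ a) (n : ℕ) (ω : q.Path) :
    ∫⁻ ω' in q.history n ⁻¹' {q.history n ω}, ENNReal.ofReal (q.expectation ρ a n ω')
        ∂(q.trajectoryMeasure ρ)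
      = ENNReal.ofReal (tr (a * q.pathState ρ n ω)).re := by
  have hm : MeasurableSet (q.history n ⁻¹' {q.history n ω}) :=
    q.measurable_history n (measurableSet_singleton _)
  rw [setLIntegral_congr_fun (g := fun _ => ENNReal.ofReal (q.expectation ρ a n ω)) hm fun ω' h => by
      rw [q.expectation_congr ρ a h],
    setLIntegral_const, trajectoryMeasure_history_fibre,
    ← ENNReal.ofReal_mul (q.expectation_nonneg ρ ha n ω), expectation_mul_re_tr]

theorem measurable_filtration_expectation (a : H →L[ℂ] H) (n : ℕ) :
    Measurable[q.filtration n] (q.expectation ρ a n) := by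
  have h : q.expectation ρ a n
      = (fun t => q.expectation ρ a n (Function.surjInv (q.history_surjective ρ n) t)) ∘
        q.history n := by
    ext ω
    exact q.expectation_congr ρ a
      (Function.surjInv_eq (q.history_surjective ρ n) (q.history n ω)).symm
  rw [h]
  exact (measurable_of_countable _).comp (comap_measurable (q.history n))

theorem measurable_expectation (a : H →L[ℂ] H) (n : ℕ) : Measurable (q.expectation ρ a n) :=
  (q.measurable_filtration_expectation ρ a n).mono (q.filtration.le n) le_rfl

theorem history_fibre_eq_iUnion (n : ℕ) (ω : q.Path) :
    q.history n ⁻¹' {q.history n ω} = ⋃ j, q.history (n + 1) ⁻¹'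
      {q.history (n + 1) (ω.1, Function.update ω.2 n j)} := by
  ext ω'
  simp only [Set.mem_iUnion, Set.mem_preimage, Set.mem_singleton_iff, history_eq_iff]
  constructor
  · rintro ⟨h1, h2⟩
    refine ⟨ω'.2 n, h1, fun i hi => ?_⟩
    rcases Nat.lt_succ_iff_lt_or_eq.1 hi with hi | rfl
    · rw [Function.update_of_ne hi.ne, h2 i hi]
    · simp
  · rintro ⟨j, h1, h2⟩
    refine ⟨h1, fun i hi => ?_⟩
    rw [h2 i (by omega), Function.update_of_ne hi.ne]

/-- For a harmonic operator `a`, the process `Tr(a ρₙ)` has the martingale property on cylinders. -/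
theorem setLIntegral_expectation_succ_history_fibre (ha : 0 ≤ a) (hfix : q.dualChannel a = a)
    (n : ℕ) (ω : q.Path) :
    ∫⁻ ω' in q.history n ⁻¹' {q.history n ω}, ENNReal.ofReal (q.expectation ρ a (n + 1) ω')
        ∂(q.trajectoryMeasure ρ)
      = ENNReal.ofReal (tr (a * q.pathState ρ n ω)).re := by
  rw [history_fibre_eq_iUnion, lintegral_iUnion
    (fun j => q.measurable_history (n + 1) (measurableSet_singleton _)), tsum_fintype]
  · simp only [setLIntegral_expectation_history_fibre q ρ ha]
    rw [← ENNReal.ofReal_sum_of_nonneg fun j _ => re_tr_mul_nonneg ha (q.pathState_nonneg ρ _ _),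
      ← Complex.re_sum]
    have h1 : ∀ j, q.pathState ρ (n + 1) (ω.1, Function.update ω.2 n j)
        = q.L j * q.pathState ρ n ω * star (q.L j) := fun j => by
      rw [pathState_succ, q.pathState_congr ρ (ω := (ω.1, Function.update ω.2 n j)) (ω' := ω)]
      · simp only [Function.update_self]
      exact q.history_eq_iff.2 ⟨rfl, fun i hi => Function.update_of_ne hi.ne _ _⟩
    simp only [h1]
    -- The sum over the last shift rebuilds `𝔏`, which duality moves onto the harmonic `a`.
    rw [← tr_sum, ← Finset.mul_sum, ← localChannel_apply, tr_mul_comm, ← tr_mul_dualChannel, hfix,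
      tr_mul_comm]
  · intro j j' hjj'
    refine Set.disjoint_left.2 fun ω' h h' => hjj' ?_
    have h1 := (q.history_eq_iff.1 h).2 n (Nat.lt_succ_self n)
    have h2 := (q.history_eq_iff.1 h').2 n (Nat.lt_succ_self n)
    simp only [Function.update_self] at h1 h2
    exact h1.symm.trans h2

/-- An event of `ℱₙ` is a countable disjoint union of history fibres, on each of which both
integrals equal `Tr(a σₙ)`. -/
theorem setLIntegral_expectation_succ (ha : 0 ≤ a) (hfix : q.dualChannel a = a) (n : ℕ)
    {B : Set q.Path} (hB : MeasurableSet[q.filtration n] B) :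
    ∫⁻ ω in B, ENNReal.ofReal (q.expectation ρ a (n + 1) ω) ∂(q.trajectoryMeasure ρ)
      = ∫⁻ ω in B, ENNReal.ofReal (q.expectation ρ a n ω) ∂(q.trajectoryMeasure ρ) := by
  obtain ⟨S, hS, rfl⟩ := hB
  change ∫⁻ ω in q.history n ⁻¹' S, _ ∂_ = ∫⁻ ω in q.history n ⁻¹' S, _ ∂_
  rw [← Set.biUnion_preimage_singleton]
  have hm : ∀ t ∈ S, MeasurableSet (q.history n ⁻¹' {t}) := fun t _ =>
    q.measurable_history n (measurableSet_singleton _)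
  have hd : S.PairwiseDisjoint fun t => q.history n ⁻¹' {t} :=
    fun t _ t' _ h => Disjoint.preimage _ (Set.disjoint_singleton.2 h)
  rw [lintegral_biUnion S.to_countable hm hd, lintegral_biUnion S.to_countable hm hd]
  congr 1
  ext t
  obtain ⟨ω, hω⟩ := q.history_surjective ρ n t
  rw [← hω, setLIntegral_expectation_succ_history_fibre q ρ ha hfix,
    setLIntegral_expectation_history_fibre q ρ ha]

theorem setLIntegral_expectation_of_le (ha : 0 ≤ a) (hfix : q.dualChannel a = a) {n m : ℕ}
    (hnm : n ≤ m) {B : Set q.Path} (hB : MeasurableSet[q.filtration n] B) :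
    ∫⁻ ω in B, ENNReal.ofReal (q.expectation ρ a m ω) ∂(q.trajectoryMeasure ρ)
      = ∫⁻ ω in B, ENNReal.ofReal (q.expectation ρ a n ω) ∂(q.trajectoryMeasure ρ) := by
  induction m, hnm using Nat.le_induction with
  | base => rfl
  | succ m hm ih =>
    rw [← ih]
    exact q.setLIntegral_expectation_succ ρ ha hfix m (q.filtration.mono hm B hB)

theorem lintegral_expectation_zero (ha : 0 ≤ a) :
    ∫⁻ ω, ENNReal.ofReal (q.expectation ρ a 0 ω) ∂(q.trajectoryMeasure ρ)
      = ∑' k, ENNReal.ofReal (tr (a * ρ.block k)).re := by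
  obtain ⟨j⟩ := q.nonempty_fin ρ
  have hU : (Set.univ : Set q.Path)
      = ⋃ k : q.Site, q.history 0 ⁻¹' {q.history 0 (k, fun _ => j)} := by
    ext ω
    simp [history_eq_iff]
  rw [← setLIntegral_univ, hU, lintegral_iUnion
    (fun k => q.measurable_history 0 (measurableSet_singleton _))]
  · simp only [setLIntegral_expectation_history_fibre q ρ ha]
    rfl
  · intro k k' hkk'
    refine Set.disjoint_left.2 fun ω h h' => hkk' ?_
    exact (q.history_eq_iff.1 h).1.symm.trans (q.history_eq_iff.1 h').1

theorem hasSum_re_tr_block : HasSum (fun k => (tr (ρ.block k)).re) 1 := by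
  simpa using Complex.reCLM.hasSum ρ.hasSum_tr

instance isProbabilityMeasure_trajectoryMeasure : IsProbabilityMeasure (q.trajectoryMeasure ρ) := by
  obtain ⟨j⟩ := q.nonempty_fin ρ
  have hU : (Set.univ : Set q.Path)
      = ⋃ k : q.Site, q.history 0 ⁻¹' {q.history 0 (k, fun _ => j)} := by
    ext ω
    simp [history_eq_iff]
  refine ⟨?_⟩
  rw [hU, measure_iUnion _ fun k => q.measurable_history 0 (measurableSet_singleton _)]
  · simp only [trajectoryMeasure_history_fibre]
    change ∑' k, ENNReal.ofReal (tr (ρ.block k)).re = 1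
    rw [← ENNReal.ofReal_tsum_of_nonneg (fun k => re_tr_nonneg (ρ.positive k))
      (hasSum_re_tr_block q ρ).summable, (hasSum_re_tr_block q ρ).tsum_eq, ENNReal.ofReal_one]
  · intro k k' hkk'
    refine Set.disjoint_left.2 fun ω h h' => hkk' ?_
    exact (q.history_eq_iff.1 h).1.symm.trans (q.history_eq_iff.1 h').1

theorem integrable_expectation (ha0 : 0 ≤ a) (ha1 : a ≤ 1) (n : ℕ) :
    Integrable (q.expectation ρ a n) (q.trajectoryMeasure ρ) :=
  Integrable.of_bound (q.measurable_expectation ρ a n).aestronglyMeasurable 1 <|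
    Eventually.of_forall fun ω => by
      rw [Real.norm_of_nonneg (q.expectation_nonneg ρ ha0 n ω)]
      exact q.expectation_le_one ρ ha1 n ω

theorem martingale_expectation (ha0 : 0 ≤ a) (ha1 : a ≤ 1) (hfix : q.dualChannel a = a) :
    Martingale (q.expectation ρ a) q.filtration (q.trajectoryMeasure ρ) := by
  refine martingale_of_setIntegral_eq_succ
    (fun n => (q.measurable_filtration_expectation ρ a n).stronglyMeasurable)
    (q.integrable_expectation ρ ha0 ha1) fun n B hB => ?_
  rw [integral_eq_lintegral_of_nonneg_ae
      (Eventually.of_forall (q.expectation_nonneg ρ ha0 n))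
      (q.measurable_expectation ρ a n).aestronglyMeasurable,
    integral_eq_lintegral_of_nonneg_ae
      (Eventually.of_forall (q.expectation_nonneg ρ ha0 (n + 1)))
      (q.measurable_expectation ρ a (n + 1)).aestronglyMeasurable,
    q.setLIntegral_expectation_succ ρ ha0 hfix n hB]

theorem ae_exists_tendsto_expectation (ha0 : 0 ≤ a) (ha1 : a ≤ 1) (hfix : q.dualChannel a = a) :
    ∀ᵐ ω ∂(q.trajectoryMeasure ρ), ∃ y,
      Tendsto (fun n => q.expectation ρ a n ω) atTop (𝓝 y) := by
  refine (q.martingale_expectation ρ ha0 ha1 hfix).submartingale.exists_ae_tendsto_of_bdd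
    (R := 1) fun n => ?_
  refine (eLpNorm_le_of_ae_bound (C := 1) (Eventually.of_forall fun ω => ?_)).trans ?_
  · rw [Real.norm_of_nonneg (q.expectation_nonneg ρ ha0 n ω)]
    exact q.expectation_le_one ρ ha1 n ω
  · simp

end Expectation

/-! ## The measures attached to an enclosure -/

section Absorption

variable (q : HOQRW d H) (ρ : q.DiagonalState) {W : Submodule ℂ H}

theorem absorbedMass_eq_expectation (W : Submodule ℂ H) :
    q.absorbedMass ρ W = q.expectation ρ (q.absorption W) := rfl

theorem ae_tendsto_absorbedMass (hW : IsEnclosure q.localChannel W) :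
    ∀ᵐ ω ∂(q.trajectoryMeasure ρ), Tendsto (fun n => q.absorbedMass ρ W n ω) atTop
      (𝓝 (q.absorbedMassLimit ρ W ω)) := by
  filter_upwards [q.ae_exists_tendsto_expectation ρ (q.absorption_nonneg hW)
    (q.absorption_le_one hW) (q.dualChannel_absorption hW)] with ω hω
  exact tendsto_nhds_limUnder hω

theorem aemeasurable_absorbedMassLimit (hW : IsEnclosure q.localChannel W) :
    AEMeasurable (q.absorbedMassLimit ρ W) (q.trajectoryMeasure ρ) :=
  aemeasurable_of_tendsto_metrizable_ae atTop
    (fun n => (q.measurable_expectation ρ (q.absorption W) n).aemeasurable)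
    (q.ae_tendsto_absorbedMass ρ hW)

theorem ae_absorbedMassLimit_nonneg (hW : IsEnclosure q.localChannel W) :
    ∀ᵐ ω ∂(q.trajectoryMeasure ρ), 0 ≤ q.absorbedMassLimit ρ W ω := by
  filter_upwards [q.ae_tendsto_absorbedMass ρ hW] with ω hω
  exact ge_of_tendsto' hω fun n => q.expectation_nonneg ρ (q.absorption_nonneg hW) n ω

/-- The absorbed mass is the conditional expectation of its limit. -/
theorem setLIntegral_absorbedMassLimit (hW : IsEnclosure q.localChannel W) (n : ℕ)
    {B : Set q.Path} (hB : MeasurableSet[q.filtration n] B) :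
    ∫⁻ ω in B, ENNReal.ofReal (q.absorbedMassLimit ρ W ω) ∂(q.trajectoryMeasure ρ)
      = ∫⁻ ω in B, ENNReal.ofReal (q.absorbedMass ρ W n ω) ∂(q.trajectoryMeasure ρ) := by
  have h1 : Tendsto (fun m => ∫⁻ ω in B, ENNReal.ofReal (q.absorbedMass ρ W m ω)
      ∂(q.trajectoryMeasure ρ)) atTop
      (𝓝 (∫⁻ ω in B, ENNReal.ofReal (q.absorbedMassLimit ρ W ω) ∂(q.trajectoryMeasure ρ))) := by
    refine tendsto_lintegral_of_dominated_convergence (fun _ => 1)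
      (fun m => (q.measurable_expectation ρ (q.absorption W) m).ennreal_ofReal)
      (fun m => Eventually.of_forall fun ω => ?_) (by simp) ?_
    · exact ENNReal.ofReal_le_one.2 (q.expectation_le_one ρ (q.absorption_le_one hW) m ω)
    · filter_upwards [ae_restrict_of_ae (q.ae_tendsto_absorbedMass ρ hW)] with ω hω
      exact (ENNReal.continuous_ofReal.tendsto _).comp hω
  -- The integrals over `B ∈ ℱₙ` are constant in `m` from `m = n` on.
  refine tendsto_nhds_unique h1 (tendsto_const_nhds.congr' ?_)
  filter_upwards [eventually_ge_atTop n] with m hm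
  exact (q.setLIntegral_expectation_of_le ρ (q.absorption_nonneg hW)
    (q.dualChannel_absorption hW) hm hB).symm

theorem absorptionWeight_nonneg (hW : IsEnclosure q.localChannel W) :
    0 ≤ q.absorptionWeight ρ W :=
  integral_nonneg fun ω => q.expectation_nonneg ρ (q.absorption_nonneg hW) 0 ω

theorem ofReal_absorptionWeight (hW : IsEnclosure q.localChannel W) :
    ENNReal.ofReal (q.absorptionWeight ρ W)
      = ∫⁻ ω, ENNReal.ofReal (q.absorbedMass ρ W 0 ω) ∂(q.trajectoryMeasure ρ) :=
  ofReal_integral_eq_lintegral_ofReal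
    (q.integrable_expectation ρ (q.absorption_nonneg hW) (q.absorption_le_one hW) 0)
    (Eventually.of_forall (q.expectation_nonneg ρ (q.absorption_nonneg hW) 0))

theorem lintegral_absorbedMassLimit (hW : IsEnclosure q.localChannel W) :
    ∫⁻ ω, ENNReal.ofReal (q.absorbedMassLimit ρ W ω) ∂(q.trajectoryMeasure ρ)
      = ENNReal.ofReal (q.absorptionWeight ρ W) := by
  rw [q.ofReal_absorptionWeight ρ hW]
  simpa only [setLIntegral_univ] using
    q.setLIntegral_absorbedMassLimit ρ hW 0 (B := Set.univ) MeasurableSet.univ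

theorem hasSum_absorptionWeight (hW : IsEnclosure q.localChannel W) :
    HasSum (fun k => tr (q.absorption W * ρ.block k)) (q.absorptionWeight ρ W : ℂ) := by
  have hpos : ∀ k, 0 ≤ ρ.block k := fun k =>
    (ContinuousLinearMap.nonneg_iff_isPositive _).2 (ρ.positive k)
  have h0 : ∀ k, 0 ≤ (tr (q.absorption W * ρ.block k)).re := fun k =>
    re_tr_mul_nonneg (q.absorption_nonneg hW) (hpos k)
  have hs : Summable fun k => (tr (q.absorption W * ρ.block k)).re :=
    Summable.of_nonneg_of_le h0 (fun k => re_tr_mul_le (q.absorption_le_one hW) (hpos k))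
      (hasSum_re_tr_block q ρ).summable
  have h1 : ENNReal.ofReal (q.absorptionWeight ρ W)
      = ENNReal.ofReal (∑' k, (tr (q.absorption W * ρ.block k)).re) := by
    rw [q.ofReal_absorptionWeight ρ hW, absorbedMass_eq_expectation,
      q.lintegral_expectation_zero ρ (q.absorption_nonneg hW), ENNReal.ofReal_tsum_of_nonneg h0 hs]
  rw [ENNReal.ofReal_eq_ofReal_iff (q.absorptionWeight_nonneg ρ hW) (tsum_nonneg h0)] at h1
  rw [h1]
  have h2 := Complex.hasSum_ofReal.2 hs.hasSum
  simpa only [← tr_mul_eq_ofReal_re (q.absorption_nonneg hW) (hpos _)] using h2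

theorem absorptionMeasure_apply_of_filtration (hW : IsEnclosure q.localChannel W)
    (hpos : 0 < q.absorptionWeight ρ W) (n : ℕ) {B : Set q.Path}
    (hB : MeasurableSet[q.filtration n] B) :
    q.absorptionMeasure ρ W B = ∫⁻ ω in B,
      ENNReal.ofReal (q.absorbedMass ρ W n ω / q.absorptionWeight ρ W)
        ∂(q.trajectoryMeasure ρ) := by
  have hne : (ENNReal.ofReal (q.absorptionWeight ρ W))⁻¹ ≠ ∞ := by simpa using hpos
  rw [absorptionMeasure, withDensity_apply _ (q.filtration.le n B hB)]
  simp only [ENNReal.ofReal_div_of_pos hpos]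
  simp only [div_eq_mul_inv]
  rw [lintegral_mul_const' _ _ hne, lintegral_mul_const' _ _ hne,
    q.setLIntegral_absorbedMassLimit ρ hW n hB]

theorem isProbabilityMeasure_absorptionMeasure (hW : IsEnclosure q.localChannel W)
    (hpos : 0 < q.absorptionWeight ρ W) : IsProbabilityMeasure (q.absorptionMeasure ρ W) := by
  refine ⟨?_⟩
  rw [absorptionMeasure, withDensity_apply _ MeasurableSet.univ, setLIntegral_univ]
  simp only [ENNReal.ofReal_div_of_pos hpos]
  simp only [div_eq_mul_inv]
  rw [lintegral_mul_const' _ _ (by simpa using hpos), q.lintegral_absorbedMassLimit ρ hW]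
  exact ENNReal.mul_inv_cancel (by simpa using hpos) ENNReal.ofReal_ne_top

/-- The weight cancels the normalisation of the density. If the weight is zero, the nonnegative
density `ofReal Y_∞` has integral zero, so both sides are the zero measure. -/
theorem absorptionWeight_smul_absorptionMeasure (hW : IsEnclosure q.localChannel W) :
    ENNReal.ofReal (q.absorptionWeight ρ W) • q.absorptionMeasure ρ W
      = (q.trajectoryMeasure ρ).withDensity
        fun ω => ENNReal.ofReal (q.absorbedMassLimit ρ W ω) := by
  rcases (q.absorptionWeight_nonneg ρ hW).eq_or_lt with h | h
  · rw [← h, ENNReal.ofReal_zero, zero_smul, eq_comm, withDensity_eq_zero_iff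
      (q.aemeasurable_absorbedMassLimit ρ hW).ennreal_ofReal,
      ← lintegral_eq_zero_iff' (q.aemeasurable_absorbedMassLimit ρ hW).ennreal_ofReal,
      q.lintegral_absorbedMassLimit ρ hW, ← h, ENNReal.ofReal_zero]
  · rw [absorptionMeasure, ← withDensity_smul' _ _ ENNReal.ofReal_ne_top]
    congr 1
    ext ω
    rw [Pi.smul_apply, smul_eq_mul, ENNReal.ofReal_div_of_pos h, ENNReal.mul_div_cancel
      (by simpa using h) ENNReal.ofReal_ne_top]

end Absorption

/-! ## Convex decompositions -/

section Decomposition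

variable (q : HOQRW d H) (ρ : q.DiagonalState) {ι : Type*} [Fintype ι] {W : ι → Submodule ℂ H}

theorem sum_absorptionWeight_eq_one (hW : ∀ i, IsEnclosure q.localChannel (W i))
    (hone : ∑ i, q.absorption (W i) = 1) : ∑ i, q.absorptionWeight ρ (W i) = 1 := by
  have h1 := hasSum_sum (s := Finset.univ) fun i _ => q.hasSum_absorptionWeight ρ (hW i)
  simp only [← tr_sum, ← Finset.sum_mul, hone, one_mul] at h1
  exact_mod_cast h1.unique ρ.hasSum_tr

/-- The masses at time `n` add up to `Tr ρₙ`, which is only `≤ 1` pointwise since `ρₙ` may be `0` on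
a null set. The integral of the limit sum is `∑ a_{Wᵢ}(ρ) = 1`, and this forces equality almost
everywhere. -/
theorem ae_sum_absorbedMassLimit_eq_one (hW : ∀ i, IsEnclosure q.localChannel (W i))
    (hone : ∑ i, q.absorption (W i) = 1) :
    ∀ᵐ ω ∂(q.trajectoryMeasure ρ),
      ∑ i, ENNReal.ofReal (q.absorbedMassLimit ρ (W i) ω) = 1 := by
  have hle : (fun ω => ∑ i, ENNReal.ofReal (q.absorbedMassLimit ρ (W i) ω))
      ≤ᵐ[q.trajectoryMeasure ρ] fun _ => 1 := by
    filter_upwards [ae_all_iff.2 fun i => q.ae_tendsto_absorbedMass ρ (hW i),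
      ae_all_iff.2 fun i => q.ae_absorbedMassLimit_nonneg ρ (hW i)] with ω h1 h2
    rw [← ENNReal.ofReal_sum_of_nonneg fun i _ => h2 i, ENNReal.ofReal_le_one]
    refine le_of_tendsto' (tendsto_finsetSum Finset.univ fun i _ => h1 i) fun n => ?_
    have h3 : ∑ i, q.absorbedMass ρ (W i) n ω = q.expectation ρ 1 n ω := by
      simp only [absorbedMass, expectation]
      rw [← Complex.re_sum, ← tr_sum, ← Finset.sum_mul, hone]
    rw [h3]
    exact q.expectation_le_one ρ le_rfl n ω
  have hint : ∫⁻ ω, ∑ i, ENNReal.ofReal (q.absorbedMassLimit ρ (W i) ω)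
      ∂(q.trajectoryMeasure ρ) = 1 := by
    rw [lintegral_finsetSum' _ fun i _ => (q.aemeasurable_absorbedMassLimit ρ (hW i)).ennreal_ofReal]
    simp only [q.lintegral_absorbedMassLimit ρ (hW _)]
    rw [← ENNReal.ofReal_sum_of_nonneg fun i _ => q.absorptionWeight_nonneg ρ (hW i),
      q.sum_absorptionWeight_eq_one ρ hW hone, ENNReal.ofReal_one]
  exact ae_eq_of_ae_le_of_lintegral_le hle (by simp [hint]) aemeasurable_const (by simp [hint])

theorem trajectoryMeasure_eq_sum (hW : ∀ i, IsEnclosure q.localChannel (W i))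
    (hone : ∑ i, q.absorption (W i) = 1) :
    q.trajectoryMeasure ρ
      = ∑ i, ENNReal.ofReal (q.absorptionWeight ρ (W i)) • q.absorptionMeasure ρ (W i) := by
  ext B hB
  simp only [q.absorptionWeight_smul_absorptionMeasure ρ (hW _), Measure.finsetSum_apply,
    withDensity_apply _ hB]
  rw [← lintegral_finsetSum' _ fun i _ =>
      (q.aemeasurable_absorbedMassLimit ρ (hW i)).ennreal_ofReal.restrict,
    lintegral_congr_ae (ae_restrict_of_ae (q.ae_sum_absorbedMassLimit_eq_one ρ hW hone)),
    setLIntegral_one]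

end Decomposition

end HOQRW

end OpenQuantumWalk

-- The two decompositions of the trajectory measure

theorem lemma4p2 {d : ℕ} {H : Type*} [NormedAddCommGroup H] [InnerProductSpace ℂ H]
    [CompleteSpace H] [FiniteDimensional ℂ H]
    (q : OpenQuantumWalk.HOQRW d H) (ρ : q.DiagonalState)
    {A : Type*} [Fintype A] (χ : A → Submodule ℂ H)
    (hχ : OpenQuantumWalk.IsRecurrentDecomposition q.localChannel χ)
    {I : A → Type*} [∀ α, Fintype (I α)] (V : (α : A) → I α → Submodule ℂ H)
    (hV : ∀ α, OpenQuantumWalk.IsMinimalDecomposition q.localChannel (χ α) (V α)) :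
    -- the two decompositions of the trajectory measure
    (q.trajectoryMeasure ρ =
      ∑ α, ENNReal.ofReal (q.absorptionWeight ρ (χ α)) • q.absorptionMeasure ρ (χ α)) ∧
    (q.trajectoryMeasure ρ =
      ∑ α, ∑ β, ENNReal.ofReal (q.absorptionWeight ρ (V α β)) • q.absorptionMeasure ρ (V α β)) ∧
    -- the weights are those of convex combinations
    (∀ α, 0 ≤ q.absorptionWeight ρ (χ α)) ∧ (∑ α, q.absorptionWeight ρ (χ α) = 1) ∧
    (∀ α β, 0 ≤ q.absorptionWeight ρ (V α β)) ∧
    (∑ α, ∑ β, q.absorptionWeight ρ (V α β) = 1) ∧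
    -- the other expression of the weights
    (∀ α, HasSum (fun k => OpenQuantumWalk.tr (q.absorption (χ α) * ρ.block k))
      (q.absorptionWeight ρ (χ α) : ℂ)) ∧
    (∀ α β, HasSum (fun k => OpenQuantumWalk.tr (q.absorption (V α β) * ρ.block k))
      (q.absorptionWeight ρ (V α β) : ℂ)) ∧
    -- for each enclosure: the limits exist, and the component is a probability measure with the
    -- stated densities on the filtration as soon as its weight is positive
    (∀ W : Submodule ℂ H, OpenQuantumWalk.IsEnclosure q.localChannel W →
      Tendsto (fun n : ℕ => (q.dualChannel ^ n) W.starProjection) atTop (𝓝 (q.absorption W)) ∧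
      (∀ᵐ ω ∂(q.trajectoryMeasure ρ), Tendsto (fun n => q.absorbedMass ρ W n ω) atTop
        (𝓝 (q.absorbedMassLimit ρ W ω))) ∧
      (0 < q.absorptionWeight ρ W →
        IsProbabilityMeasure (q.absorptionMeasure ρ W) ∧
        ∀ (n : ℕ) (B : Set q.Path), MeasurableSet[q.filtration n] B →
          q.absorptionMeasure ρ W B = ∫⁻ ω in B,
            ENNReal.ofReal (q.absorbedMass ρ W n ω / q.absorptionWeight ρ W)
              ∂(q.trajectoryMeasure ρ))) := by
  have hχe : ∀ α, OpenQuantumWalk.IsEnclosure q.localChannel (χ α) := fun α => (hχ.minimal α).prop.1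
  have hVe : ∀ α β, OpenQuantumWalk.IsEnclosure q.localChannel (V α β) := fun α β =>
    ((hV α).minimal β).prop.1
  have hVe' : ∀ i : (α : A) × I α, OpenQuantumWalk.IsEnclosure q.localChannel (V i.1 i.2) :=
    fun i => hVe i.1 i.2
  have hχone := q.sum_absorption_eq_one hχe hχ.orthogonal hχ.iSup_eq
  -- Indexed by pairs, the `V α β` form a single orthogonal family spanning `R`: inside one `χ α` by
  -- its own decomposition, across different `α` because the `χ α` are orthogonal.
  have hVone : ∑ i : (α : A) × I α, q.absorption (V i.1 i.2) = 1 := by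
    refine q.sum_absorption_eq_one hVe' ?_ ?_
    · rintro ⟨α, β⟩ ⟨α', β'⟩ hne
      by_cases h : α = α'
      · subst h
        exact (hV α).orthogonal β β' fun h => hne (h ▸ rfl)
      · exact (hχ.orthogonal α α' h).mono ((hV α).iSup_eq ▸ le_iSup (V α) β)
          ((hV α').iSup_eq ▸ le_iSup (V α') β')
    · rw [iSup_sigma, ← hχ.iSup_eq]
      exact iSup_congr fun α => (hV α).iSup_eq
  refine ⟨q.trajectoryMeasure_eq_sum ρ hχe hχone, ?_, fun α => q.absorptionWeight_nonneg ρ (hχe α),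
    q.sum_absorptionWeight_eq_one ρ hχe hχone, fun α β => q.absorptionWeight_nonneg ρ (hVe α β), ?_,
    fun α => q.hasSum_absorptionWeight ρ (hχe α), fun α β => q.hasSum_absorptionWeight ρ (hVe α β),
    fun W hW => ⟨q.tendsto_absorption hW, q.ae_tendsto_absorbedMass ρ hW, fun hpos =>
      ⟨q.isProbabilityMeasure_absorptionMeasure ρ hW hpos, fun n B hB =>
        q.absorptionMeasure_apply_of_filtration ρ hW hpos n hB⟩⟩⟩
  · exact (q.trajectoryMeasure_eq_sum ρ hVe' hVone).trans (Fintype.sum_sigma _)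
  · exact (Fintype.sum_sigma _).symm.trans (q.sum_absorptionWeight_eq_one ρ hVe' hVone)
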